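/- **Setting.** Let $d\in\{1,2,3\}$ and let $v=\sum_{j=1}^n\delta_{\alpha_j}(x-y_j)$ be a multipoint potential of Bethe–Peierls–Thomas–Fermi type on $\mathbb R^d$, i.e. $n\in\mathbb N\cup\{0\}$, $y_j\in\mathbb R^d$ are distinct and $\alpha_j\in\mathbb C$ (with $\alpha_j\neq 0$ if $d=1$, where $\delta_\alpha=-\alpha^{-1}\delta$). Two potentials are identified if their pairs $(y_j,\alpha_j)$ agree up to relabelling. For $\kappa>0$ let $A(\kappa)$ be the $n\times n$ matrix with diagonal entries $\alpha_j+(2i\kappa)^{-1}$ ($d=1$), $\alpha_j-(4\pi)^{-1}(\pi i-2\ln\kappa)$ ($d=2$), $\alpha_j-i(4\pi)^{-1}\kappa$ ($d=3$), and off-diagonal entries $G^+(y_j-y_{j'},\kappa)$, where $G^+(x,\kappa)$ is $\frac{e^{i\kappa|x|}}{2i\kappa}$ ($d=1$), $-\frac i4H_0^{(1)}(\kappa|x|)$ ($d=2$), $-\frac{e^{i\kappa|x|}}{4\pi|x|}$ ($d=3$). For $|k|=|l|=\kappa=\sqrt E$ such that $A(\kappa)$ is invertible, the scattering amplitude is $f(k,l)=(2\pi)^{-d}\sum_jq_j(k)e^{-il\cdot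 y_j}$, where $A(\kappa)q(k)=-(e^{ik\cdot y_j})_j$. Put $\mathcal Fu(p)=(2\pi)^{-d}\int e^{ip\cdot x}\,du(x)$ for a complex measure $u$. For $d\ge2$ fix any $\gamma:\mathbb R^d\to\mathbb R^d$ with $|\gamma(p)|=1$, $\gamma(p)\cdot p=0$, and for $|p|<2\sqrt E$ put $$k_E(p)=\tfrac p2+(E-\tfrac{p^2}4)^{1/2}\gamma(p),\qquad l_E(p)=-\tfrac p2+(E-\tfrac{p^2}4)^{1/2}\gamma(p).$$ Let $$v_{2,1}=-2\pi\sum_j\delta_{y_j},\quad v_{2,2}=4\pi^2\sum_j(\alpha_j-\tfrac i4)\delta_{y_j}\quad(d=2),\qquad v_{3,1}=-4\pi i\sum_j\delta_{y_j},\quad v_{3,2}^1=-16\pi^2\sum_j\alpha_j\delta_{y_j}\quad(d=3),$$ $$f_{3,2}^2(k,l)=\sum_{j\ne j'}\frac{e^{i\kappa|y_j-y_{j'}|}}{2\pi^2|y_j-y_{j'}|}e^{i(k\cdot y_j-l\cdot y_{j'})}.$$ **Theorem.** $A(\kappa)$ is invertible for all sufficiently large $\kappa$. The scattering amplitude at high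 energies (i.e. at all energies $E>E_0$ at which it is defined, for an arbitrary fixed $E_0>0$) uniquely determines $v$, as follows. * **$d=2$.** For each fixed $p\in\mathbb R^2$, as $\kappa=\sqrt E\to+\infty$, $$f(k_E(p),l_E(p))=\frac{\mathcal Fv_{2,1}(p)}{\ln\kappa}+\frac{\mathcal Fv_{2,2}(p)}{(\ln\kappa)^2}+O\big((\ln\kappa)^{-3}\big),$$ so that $f(k_E(p),l_E(p))$ at high energies determines $\mathcal Fv_{2,1}(p)=\lim\,(\ln\kappa) f$ and $\mathcal Fv_{2,2}(p)=\lim\,(\ln\kappa)^2\big(f-(\ln\kappa)^{-1}\mathcal Fv_{2,1}(p)\big)$. In turn, $\mathcal Fv_{2,j}$ uniquely determines $v_{2,j}$, $j=1,2$. Further, $\mathcal Fv_{2,1}$ uniquely determines the set of all $y_j$; $\mathcal Fv_{2,2}$ alone uniquely determines all pairs $(y_j,\alpha_j)$ with $\alpha_j\ne\frac i4$, hence all $y_j$ and $\alpha_j$ within the class of potentials none of whose strengths equals $\frac i4$; and $\mathcal Fv_{2,1}$, $\mathcal Fv_{2,2}$ together always determine $v$. Hence $f(k_E(p),l_E(p))$,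 $p\in\mathbb R^2$, at high energies uniquely determines $v$. * **$d=3$.** For each fixed $p\in\mathbb R^3$, as $\kappa=\sqrt E\to+\infty$, $$f(k_E(p),l_E(p))=\frac{\mathcal Fv_{3,1}(p)}{\kappa}+\frac{\mathcal Fv_{3,2}^1(p)+f_{3,2}^2(k_E(p),l_E(p))}{\kappa^2}+O(\kappa^{-3}),$$ so that $f(k_E(p),l_E(p))$ at high energies determines $\mathcal Fv_{3,1}(p)=\lim\,\kappa f$. In turn, $\mathcal Fv_{3,1}$ uniquely determines $v_{3,1}$, or, equivalently, the set of all $y_j$. The $y_j$ determine $f_{3,2}^2$, and then $f(k_E(p),l_E(p))$ at high energies determines $\mathcal Fv_{3,2}^1(p)=\lim\big[\kappa^2\big(f-\kappa^{-1}\mathcal Fv_{3,1}(p)\big)-f_{3,2}^2(k_E(p),l_E(p))\big]$. In turn, $\mathcal Fv_{3,2}^1$ uniquely determines $v_{3,2}^1$ and all pairs $(y_j,\alpha_j)$ with $\alpha_j\neq0$, hence all $y_j$ and $\alpha_j$ within the class of potentials without zero strengths; and the $y_j$ and $\mathcal Fv_{3,2}^1$ together always determine $v$. Hence $f(k_E(p),l_E(p))$,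 $p\in\mathbb R^3$, at high energies uniquely determines $v$. * **$d=1$.** Let $E_0>0$ be such that $A(\kappa)$ is invertible for all $\kappa\ge\sqrt{E_0}$ (which holds for all sufficiently large $E_0$). Then, in the sense of tempered distributions, with $v=-\sum_j\alpha_j^{-1}\delta_{y_j}$, $$v(x)-\int_{|p|>2\sqrt{E_0}}e^{-ipx}f\big(\tfrac p2,-\tfrac p2\big)\,dp\in L^s(\mathbb R)\qquad\text{for all }2\le s<\infty,$$ and, for each such $s$, $v$ is the only multipoint potential for which this difference (with the same $f$) lies in $L^s(\mathbb R)$. Moreover $f(k,-k)$ at high energies (arbitrary $E_0>0$) uniquely determines $v$. -/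

import Mathlib

open MeasureTheory Filter Topology Asymptotics
open scoped ENNReal SchwartzMap

noncomputable section

/-- The Bessel function `J₀(r) = π⁻¹ ∫₀^π cos (r sin θ) dθ` (Bessel's integral). -/
def besselJ0 (r : ℝ) : ℝ :=
  Real.pi⁻¹ * ∫ θ in (0 : ℝ)..Real.pi, Real.cos (r * Real.sin θ)

/-- The Bessel function of the second kind
`Y₀(r) = π⁻¹ ∫₀^π sin (r sin θ) dθ - 2 π⁻¹ ∫₀^∞ exp (-r sinh t) dt`, for `r > 0`
(Schläfli's integral). -/
def besselY0 (r : ℝ) : ℝ :=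
  Real.pi⁻¹ * (∫ θ in (0 : ℝ)..Real.pi, Real.sin (r * Real.sin θ))
    - 2 * Real.pi⁻¹ * ∫ t in Set.Ioi (0 : ℝ), Real.exp (-(r * Real.sinh t))

/-- The Hankel function of the first kind and order zero, `H₀⁽¹⁾ = J₀ + i Y₀`, on `r > 0`. -/
def hankelH0 (r : ℝ) : ℂ := (besselJ0 r : ℂ) + Complex.I * (besselY0 r : ℂ)

/-- A multipoint potential `v = ∑ j, δ_{α j} (x - y j)` of Bethe-Peierls-Thomas-Fermi type on `V`:
finitely many distinct points `y j` with strengths `α j`; `n = 0` is the zero potential. -/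
structure MultipointPotential (V : Type*) where
  /-- the number of points -/
  n : ℕ
  /-- the points -/
  y : Fin n → V
  /-- the strengths -/
  α : Fin n → ℂ
  y_injective : Function.Injective y

/-- The Green function `G⁺(x, κ)` of `Δ + κ²` with the Sommerfeld radiation condition, in
dimensions one, two and three (the value in other dimensions is never used). -/
def greenPlus {V : Type*} [NormedAddCommGroup V] [InnerProductSpace ℝ V] (x : V) (κ : ℝ) : ℂ :=
  match Module.finrank ℝ V with
  | 1 => Complex.exp (Complex.I * κ * ‖x‖) / (2 * Complex.I * κ)
  | 2 => -(Complex.I / 4) * hankelH0 (‖x‖ * κ)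
  | 3 => -(Complex.exp (Complex.I * κ * ‖x‖) / (4 * Real.pi * ‖x‖))
  | _ => 0

/-- The diagonal entry of the matrix `A(κ)` for a point of strength `α`, in dimension `d`. -/
def diagonalEntry (d : ℕ) (α : ℂ) (κ : ℝ) : ℂ :=
  match d with
  | 1 => α + (2 * Complex.I * κ)⁻¹
  | 2 => α - (4 * Real.pi : ℂ)⁻¹ * (Real.pi * Complex.I - 2 * (Real.log κ : ℂ))
  | 3 => α - Complex.I * (4 * Real.pi : ℂ)⁻¹ * κ
  | _ => 0

namespace MultipointPotential

section Scattering

variable {V : Type*} [NormedAddCommGroup V] [InnerProductSpace ℝ V]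

/-- The matrix `A(κ)`. -/
def matrixA (v : MultipointPotential V) (κ : ℝ) : Matrix (Fin v.n) (Fin v.n) ℂ :=
  Matrix.of fun i j =>
    if i = j then diagonalEntry (Module.finrank ℝ V) (v.α i) κ else greenPlus (v.y i - v.y j) κ

/-- The right-hand side `b(k) = -(exp (i k · y j))_j`. -/
def vectorB (v : MultipointPotential V) (k : V) : Fin v.n → ℂ :=
  fun j => -Complex.exp (Complex.I * (inner ℝ k (v.y j) : ℝ))

/-- The system `A(κ) q = b` is uniquely solvable. -/
def SolvableAt (v : MultipointPotential V) (κ : ℝ) : Prop := IsUnit (v.matrixA κ).det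

/-- The solution `q(k)` of `A(κ) q(k) = b(k)`, where `κ = ‖k‖`. -/
def chargeQ (v : MultipointPotential V) (k : V) : Fin v.n → ℂ :=
  (v.matrixA ‖k‖)⁻¹.mulVec (v.vectorB k)

/-- The scattering amplitude `f(k, l) = (2π)⁻ᵈ ∑ j, q_j(k) exp (-i l · y j)`, for `‖k‖ = ‖l‖ = κ`
such that the system `A(κ) q = b` is uniquely solvable. -/
def amplitude (v : MultipointPotential V) (k l : V) : ℂ :=
  ((2 * Real.pi : ℂ) ^ Module.finrank ℝ V)⁻¹ *
    ∑ j, v.chargeQ k j * Complex.exp (-(Complex.I * (inner ℝ l (v.y j) : ℝ)))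

/-- The two potentials are the same formal sum: their points and strengths agree up to
relabelling. -/
def Same (v w : MultipointPotential V) : Prop :=
  ∃ e : Fin v.n ≃ Fin w.n, ∀ j, w.y (e j) = v.y j ∧ w.α (e j) = v.α j

/-- The two potentials have the same set of points `{y j}`. -/
def SamePoints (v w : MultipointPotential V) : Prop := Set.range v.y = Set.range w.y

/-- `v` has a point at `x` with strength `a`. -/
def HasPoint (v : MultipointPotential V) (x : V) (a : ℂ) : Prop := ∃ j, v.y j = x ∧ v.α j = a

end Scattering

end MultipointPotential

/-- The complex measure `∑ j, c j δ_{y j}`. -/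
def discreteMeasure {V : Type*} [MeasurableSpace V] {n : ℕ} (c : Fin n → ℂ) (y : Fin n → V) :
    ComplexMeasure V :=
  ∑ j, VectorMeasure.dirac (y j) (c j)

/-- The Fourier transform `ℱμ(p) = (2π)⁻ᵈ ∫ exp (i p · x) dμ(x)` of a complex measure. -/
def fourierOfMeasure {V : Type*} [NormedAddCommGroup V] [InnerProductSpace ℝ V]
    [MeasurableSpace V] (μ : ComplexMeasure V) (p : V) : ℂ :=
  ((2 * Real.pi : ℂ) ^ Module.finrank ℝ V)⁻¹ *
    ∫ᵛ x, Complex.exp (Complex.I * (inner ℝ p x : ℝ)) ∂[ContinuousLinearMap.mul ℝ ℂ; μ]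

namespace MultipointPotential

/-- `v₁,₁ = v = -∑ j, (α j)⁻¹ δ_{y j}` in dimension one. -/
def v11 (v : MultipointPotential ℝ) : ComplexMeasure ℝ :=
  discreteMeasure (fun j => -1 / v.α j) v.y

/-- `v₂,₁ = -2π ∑ j, δ_{y j}`. -/
def v21 (v : MultipointPotential (EuclideanSpace ℝ (Fin 2))) :
    ComplexMeasure (EuclideanSpace ℝ (Fin 2)) :=
  discreteMeasure (fun _ => -2 * (Real.pi : ℂ)) v.y

/-- `v₂,₂ = 4π² ∑ j, (α j - i/4) δ_{y j}`. -/
def v22 (v : MultipointPotential (EuclideanSpace ℝ (Fin 2))) :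
    ComplexMeasure (EuclideanSpace ℝ (Fin 2)) :=
  discreteMeasure (fun j => 4 * (Real.pi : ℂ) ^ 2 * (v.α j - Complex.I / 4)) v.y

/-- `v₃,₁ = -4πi ∑ j, δ_{y j}`. -/
def v31 (v : MultipointPotential (EuclideanSpace ℝ (Fin 3))) :
    ComplexMeasure (EuclideanSpace ℝ (Fin 3)) :=
  discreteMeasure (fun _ => -4 * (Real.pi : ℂ) * Complex.I) v.y

/-- `v₃,₂¹ = -16π² ∑ j, α j δ_{y j}`. -/
def v321 (v : MultipointPotential (EuclideanSpace ℝ (Fin 3))) :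
    ComplexMeasure (EuclideanSpace ℝ (Fin 3)) :=
  discreteMeasure (fun j => -16 * (Real.pi : ℂ) ^ 2 * v.α j) v.y

/-- `f₃,₂²(k, l) = ∑_{j ≠ j'} exp (iκ|y j - y j'|) (2π²|y j - y j'|)⁻¹ exp (i(k · y j - l · y j'))`,
where `κ = ‖k‖`. -/
def f322 (v : MultipointPotential (EuclideanSpace ℝ (Fin 3))) (k l : EuclideanSpace ℝ (Fin 3)) :
    ℂ :=
  ∑ j, ∑ j', if j = j' then 0 else
    Complex.exp (Complex.I * ‖k‖ * ‖v.y j - v.y j'‖) / (2 * (Real.pi : ℂ) ^ 2 * ‖v.y j - v.y j'‖) *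
      Complex.exp (Complex.I * ((inner ℝ k (v.y j) : ℝ) - (inner ℝ l (v.y j') : ℝ)))

end MultipointPotential

section Parametrization

variable {V : Type*} [NormedAddCommGroup V] [InnerProductSpace ℝ V]

/-- A vector function with `|γ(p)| = 1` and `γ(p) · p = 0` for all `p`. -/
def IsUnitTransverse (γ : V → V) : Prop := ∀ p, ‖γ p‖ = 1 ∧ inner ℝ (γ p) p = 0

/-- `k_E(p) = p/2 + (E - p²/4)^{1/2} γ(p)`. -/
def kE (γ : V → V) (E : ℝ) (p : V) : V := (2 : ℝ)⁻¹ • p + √(E - ‖p‖ ^ 2 / 4) • γ p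

/-- `l_E(p) = -p/2 + (E - p²/4)^{1/2} γ(p)`. -/
def lE (γ : V → V) (E : ℝ) (p : V) : V := -((2 : ℝ)⁻¹ • p) + √(E - ‖p‖ ^ 2 / 4) • γ p

/-- The amplitudes of `v` and `w` at `(k_E(p), l_E(p))` coincide at every energy `E > E₀` with
`|p| < 2√E` at which both are defined. -/
def SameAmplitudeAbove (γ : V → V) (v w : MultipointPotential V) (E₀ : ℝ) (p : V) : Prop :=
  ∀ E : ℝ, E₀ < E → ‖p‖ < 2 * √E → v.SolvableAt √E → w.SolvableAt √E →
    v.amplitude (kE γ E p) (lE γ E p) = w.amplitude (kE γ E p) (lE γ E p)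

end Parametrization

/-- For a complex measure `μ` on the line and a function `g` on the line, the tempered distribution
`μ(x) - ∫_{|p| > 2√E₀} exp (-ipx) g(p) dp` is (well defined and) a function in `L^s(ℝ)`. -/
def DifferenceMemLs (μ : ComplexMeasure ℝ) (g : ℝ → ℂ) (E₀ : ℝ) (s : ℝ≥0∞) : Prop :=
  ∃ u : ℝ → ℂ, MemLp u s ∧ ∀ φ : 𝓢(ℝ, ℂ),
    IntegrableOn (fun p : ℝ => g p * ∫ x : ℝ, Complex.exp (-(Complex.I * p * x)) * φ x)
      {p : ℝ | 2 * √E₀ < |p|} ∧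
    (∫ᵛ x, φ x ∂[ContinuousLinearMap.mul ℝ ℂ; μ])
      - (∫ p in {p : ℝ | 2 * √E₀ < |p|}, g p * ∫ x : ℝ, Complex.exp (-(Complex.I * p * x)) * φ x)
      = ∫ x : ℝ, u x * φ x

end

/-! In dimensions two and three, `A(κ) = x(κ) • 1 + T(κ)` with a scalar `x(κ)` that grows (`log κ /
2π`, respectively `-iκ / 4π`) and a bounded `T(κ)`. Hence `A(κ)` is eventually invertible and two
Neumann steps give `q = x⁻¹ b - x⁻² T b + O(x⁻³)`. In the amplitude, each term that stays at one
point `y j` carries the phase `exp (i (k - l) · y j) = exp (i p · y j)`, so the diagonal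
contributions are Fourier transforms of discrete measures. The off-diagonal entries behave
differently. For `d = 2` they are Hankel functions, which decay like a power of `κ` and fall into
the remainder. For `d = 3` their modulus does not depend on `κ`, and they produce the oscillating
`f₃,₂²`, which involves the points only and can be subtracted once these are known.

Uniqueness rests on the linear independence of characters: the Fourier transform of a discrete
measure determines the weight at each point (`pointMass_eq_of_sum_exp_eq`). The leading measure has
a constant nonzero weight and shows every point. The second has a weight injective in the strength
that vanishes at one exceptional strength (`i/4` or `0`), where the point is invisible to it alone.

In dimension one `A(κ)` tends to `diag(α)`. Multiplication by `κ diag(α⁻¹)` restores the form `κ • 1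
+ bounded`, and a single Neumann step gives `f(p/2, -p/2) = ℱv(p) + O(1/|p|)`. So `ℱv` minus the
truncated amplitude is `O((1 + |p|)⁻¹)`. Its Fourier transform lies in every `L^s`, `2 ≤ s < ∞`, by
a dyadic decomposition and interpolation between `L²` and `L^∞`
(`memLp_fourier_of_norm_le_inv_one_add`). Point masses are separated from `L^s` functions by
shrinking bumps (`exists_schwartz_seq_tendsto_indicator`). -/

noncomputable section

/-! ### Finitely supported weights on points -/

section PointMass

variable {V : Type*}

/-- The formal combination `∑ j, c j · y j`. -/
def pointMass {n : ℕ} (c : Fin n → ℂ) (y : Fin n → V) : V →₀ ℂ := ∑ j, Finsupp.single (y j) (c j)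

theorem pointMass_apply_of_injective {n : ℕ} (c : Fin n → ℂ) {y : Fin n → V}
    (hy : Function.Injective y) (j : Fin n) : pointMass c y (y j) = c j := by
  classical
  simp [pointMass, Finsupp.finsetSum_apply, Finsupp.single_apply, hy.eq_iff]

theorem pointMass_apply_eq_zero {n : ℕ} (c : Fin n → ℂ) {y : Fin n → V} {x : V}
    (hx : x ∉ Set.range y) : pointMass c y x = 0 := by
  classical
  rw [pointMass, Finsupp.finsetSum_apply]
  refine Finset.sum_eq_zero fun j _ => ?_
  rw [Finsupp.single_apply, if_neg fun h => hx ⟨j, h⟩]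

theorem mem_range_of_pointMass_ne_zero {n : ℕ} {c : Fin n → ℂ} {y : Fin n → V} {x : V}
    (hx : pointMass c y x ≠ 0) : x ∈ Set.range y := by
  by_contra h
  exact hx (pointMass_apply_eq_zero c h)

theorem pointMass_sum {M : Type*} [AddCommMonoid M] {n : ℕ} (c : Fin n → ℂ) (y : Fin n → V)
    (f : V → ℂ → M) (h0 : ∀ x, f x 0 = 0) (hadd : ∀ x a b, f x (a + b) = f x a + f x b) :
    (pointMass c y).sum f = ∑ j, f (y j) (c j) := by
  classical
  rw [pointMass, ← Finsupp.sum_finsetSum_index h0 hadd]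
  exact Finset.sum_congr rfl fun j _ => Finsupp.sum_single_index (h0 _)

end PointMass

/-! ### Discrete measures and their weights -/

section Measure

variable {V : Type*} [MeasurableSpace V]

theorem discreteMeasure_eq_sum {n : ℕ} (c : Fin n → ℂ) (y : Fin n → V) :
    discreteMeasure c y = (pointMass c y).sum fun x a => VectorMeasure.dirac x a := by
  have key : ∀ (x : V) (a : ℂ) (s : Set V), MeasurableSet s →
      (VectorMeasure.dirac x a : VectorMeasure V ℂ) s = s.indicator (fun _ => a) x := by
    intro x a s hs
    by_cases h : x ∈ s
    · rw [VectorMeasure.dirac_apply_of_mem hs h, Set.indicator_of_mem h]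
    · rw [VectorMeasure.dirac_apply_of_notMem h, Set.indicator_of_notMem h]
  rw [pointMass_sum, discreteMeasure]
  · intro x
    ext s hs
    rw [key _ _ _ hs]; simp
  · intro x a b
    ext s hs
    rw [_root_.add_apply, key _ _ _ hs, key _ _ _ hs, key _ _ _ hs]
    exact Set.indicator_add s (fun _ => a) (fun _ => b) ▸ rfl

variable [MeasurableSingletonClass V]

theorem integral_discreteMeasure {n : ℕ} (c : Fin n → ℂ) (y : Fin n → V) (f : V → ℂ) :
    ∫ᵛ x, f x ∂[ContinuousLinearMap.mul ℝ ℂ; discreteMeasure c y] = ∑ j, f (y j) * c j := by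
  rw [discreteMeasure, VectorMeasure.integral_finsetSum_vectorMeasure]
  · simp [VectorMeasure.integral_dirac]
  · intro j _
    rw [VectorMeasure.Integrable, VectorMeasure.variation_dirac]
    exact (integrable_dirac (by simp)).smul_measure (by simp)

theorem discreteMeasure_apply_singleton {n : ℕ} (c : Fin n → ℂ) (y : Fin n → V) (x : V) :
    discreteMeasure c y {x} = pointMass c y x := by
  classical
  rw [discreteMeasure, pointMass, Finsupp.finsetSum_apply, _root_.sum_apply]
  refine Finset.sum_congr rfl fun j _ => ?_
  by_cases h : y j = x
  · rw [VectorMeasure.dirac_apply_of_mem (MeasurableSet.singleton x) (by simp [h])]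
    simp [h]
  · rw [VectorMeasure.dirac_apply_of_notMem (by simp [h])]
    simp [h]

/-- Evaluation on singletons recovers the weights; conversely the measure is additive in the
weights, so it depends on them alone. Equality of measures thus becomes algebra in `V →₀ ℂ`. -/
theorem discreteMeasure_eq_iff {n m : ℕ} (c : Fin n → ℂ) (y : Fin n → V) (c' : Fin m → ℂ)
    (y' : Fin m → V) :
    discreteMeasure c y = discreteMeasure c' y' ↔ pointMass c y = pointMass c' y' := by
  refine ⟨fun h => ?_, fun h => by rw [discreteMeasure_eq_sum, h, ← discreteMeasure_eq_sum]⟩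
  ext x
  rw [← discreteMeasure_apply_singleton, h, discreteMeasure_apply_singleton]

end Measure

/-! ### Fourier uniqueness for discrete measures -/

section Fourier

variable {V : Type*} [NormedAddCommGroup V] [InnerProductSpace ℝ V]

/-- The character `p ↦ exp (i p · x)`. -/
def innerCharacter (x : V) : Multiplicative V →* ℂ where
  toFun p := Complex.exp (Complex.I * (inner ℝ p.toAdd x : ℝ))
  map_one' := by simp
  map_mul' p q := by
    rw [← Complex.exp_add, toAdd_mul, inner_add_left]
    push_cast
    ring_nf

/-- At `p = (x - x') / ‖x - x'‖²` the two phases differ by exactly one radian, and `sin 1 ≠ 0`. -/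
theorem innerCharacter_injective : Function.Injective (innerCharacter (V := V)) := by
  intro x x' h
  by_contra hne
  have hd : (0 : ℝ) < ‖x - x'‖ := norm_pos_iff.2 (sub_ne_zero.2 hne)
  have h1 := DFunLike.congr_fun h (Multiplicative.ofAdd ((‖x - x'‖ ^ 2)⁻¹ • (x - x')))
  simp only [innerCharacter, MonoidHom.coe_mk, OneHom.coe_mk, toAdd_ofAdd] at h1
  have h2 : Complex.exp (Complex.I * (inner ℝ ((‖x - x'‖ ^ 2)⁻¹ • (x - x')) (x - x') : ℝ)) = 1 := by
    rw [inner_sub_right]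
    push_cast
    rw [mul_sub, Complex.exp_sub, h1, div_self (Complex.exp_ne_zero _)]
  rw [real_inner_smul_left, real_inner_self_eq_norm_sq, inv_mul_cancel₀ (by positivity)] at h2
  have h3 := congrArg Complex.im h2
  rw [Complex.ofReal_one, mul_one, Complex.exp_im] at h3
  simp only [Complex.I_re, Real.exp_zero, Complex.I_im, one_mul, Complex.one_im] at h3
  exact (Real.sin_pos_of_pos_of_lt_pi one_pos (by linarith [Real.pi_gt_three])).ne' h3

/-- Dedekind's independence of distinct characters, applied to `p ↦ exp (i p · x)` on the additive
group `V`: the coefficients of a finite exponential sum are unique. -/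
theorem pointMass_eq_of_sum_exp_eq {n m : ℕ} {c : Fin n → ℂ} {y : Fin n → V} {c' : Fin m → ℂ}
    {y' : Fin m → V}
    (h : ∀ p : V, ∑ j, Complex.exp (Complex.I * (inner ℝ p (y j) : ℝ)) * c j
      = ∑ j, Complex.exp (Complex.I * (inner ℝ p (y' j) : ℝ)) * c' j) :
    pointMass c y = pointMass c' y' := by
  have hli : LinearIndependent ℂ fun x : V => (innerCharacter x : Multiplicative V → ℂ) :=
    (linearIndependent_monoidHom (Multiplicative V) ℂ).comp _ innerCharacter_injective
  apply hli.finsuppLinearCombination_injective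
  simp only [Finsupp.linearCombination_apply]
  rw [pointMass_sum _ _ _ (by simp) (by intros; rw [add_smul]),
    pointMass_sum _ _ _ (by simp) (by intros; rw [add_smul])]
  ext p
  simpa [innerCharacter, mul_comm] using h p.toAdd

variable [MeasurableSpace V] [BorelSpace V]

theorem fourierOfMeasure_discreteMeasure {n : ℕ} (c : Fin n → ℂ) (y : Fin n → V) (p : V) :
    fourierOfMeasure (discreteMeasure c y) p = ((2 * Real.pi : ℂ) ^ Module.finrank ℝ V)⁻¹ *
      ∑ j, Complex.exp (Complex.I * (inner ℝ p (y j) : ℝ)) * c j := by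
  rw [fourierOfMeasure, integral_discreteMeasure]

theorem pointMass_eq_of_fourierOfMeasure_eq {n m : ℕ} {c : Fin n → ℂ} {y : Fin n → V}
    {c' : Fin m → ℂ} {y' : Fin m → V}
    (h : fourierOfMeasure (discreteMeasure c y) = fourierOfMeasure (discreteMeasure c' y')) :
    pointMass c y = pointMass c' y' := by
  refine pointMass_eq_of_sum_exp_eq fun p => ?_
  have hp := congrFun h p
  rw [fourierOfMeasure_discreteMeasure, fourierOfMeasure_discreteMeasure] at hp
  exact mul_left_cancel₀ (inv_ne_zero (pow_ne_zero _ (by simp [Real.pi_ne_zero]))) hp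

end Fourier

/-! ### Recovering points and strengths from weights -/

namespace MultipointPotential

variable {V : Type*}

/-- Here `g` turns a strength into the weight at its point. A point of weight zero leaves no trace,
hence `g a ≠ 0`; a nonzero weight gives back the strength by injectivity. -/
theorem hasPoint_iff_pointMass (v : MultipointPotential V) {g : ℂ → ℂ}
    (hg : Function.Injective g) (x : V) {a : ℂ} (ha : g a ≠ 0) :
    v.HasPoint x a ↔ pointMass (fun j => g (v.α j)) v.y x = g a := by
  constructor
  · rintro ⟨j, rfl, rfl⟩
    exact pointMass_apply_of_injective _ v.y_injective j
  · intro h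
    obtain ⟨j, rfl⟩ := mem_range_of_pointMass_ne_zero (h.trans_ne ha)
    rw [pointMass_apply_of_injective _ v.y_injective] at h
    exact ⟨j, rfl, hg h⟩

theorem hasPoint_iff_of_pointMass_eq {v w : MultipointPotential V} {g : ℂ → ℂ}
    (hg : Function.Injective g)
    (h : pointMass (fun j => g (v.α j)) v.y = pointMass (fun j => g (w.α j)) w.y) (x : V) {a : ℂ}
    (ha : g a ≠ 0) : v.HasPoint x a ↔ w.HasPoint x a := by
  rw [hasPoint_iff_pointMass v hg x ha, hasPoint_iff_pointMass w hg x ha, h]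

theorem SamePoints.exists_equiv {v w : MultipointPotential V} (h : v.SamePoints w) :
    ∃ e : Fin v.n ≃ Fin w.n, ∀ j, w.y (e j) = v.y j := by
  refine ⟨(Equiv.ofInjective v.y v.y_injective).trans
    ((Equiv.setCongr h).trans (Equiv.ofInjective w.y w.y_injective).symm), fun j => ?_⟩
  have := Equiv.apply_ofInjective_symm w.y_injective
    (Equiv.setCongr h (Equiv.ofInjective v.y v.y_injective j))
  exact this

/-- Once the points are known, a zero weight is information too, so no strength has to be excluded.
-/
theorem SamePoints.same_of_pointMass_eq {v w : MultipointPotential V} (h : v.SamePoints w)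
    {g : ℂ → ℂ} (hg : Function.Injective g)
    (hm : pointMass (fun j => g (v.α j)) v.y = pointMass (fun j => g (w.α j)) w.y) :
    v.Same w := by
  obtain ⟨e, he⟩ := h.exists_equiv
  refine ⟨e, fun j => ⟨he j, hg ?_⟩⟩
  rw [← pointMass_apply_of_injective (fun j => g (w.α j)) w.y_injective (e j), he, ← hm,
    pointMass_apply_of_injective _ v.y_injective]

theorem samePoints_of_pointMass_eq {v w : MultipointPotential V} {c : Fin v.n → ℂ}
    {c' : Fin w.n → ℂ} (hc : ∀ j, c j ≠ 0) (hc' : ∀ j, c' j ≠ 0)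
    (h : pointMass c v.y = pointMass c' w.y) : v.SamePoints w := by
  apply Set.Subset.antisymm
  · rintro _ ⟨j, rfl⟩
    apply mem_range_of_pointMass_ne_zero (c := c')
    rw [← h, pointMass_apply_of_injective _ v.y_injective]
    exact hc j
  · rintro _ ⟨j, rfl⟩
    apply mem_range_of_pointMass_ne_zero (c := c)
    rw [h, pointMass_apply_of_injective _ w.y_injective]
    exact hc' j

theorem SamePoints.pointMass_const_eq {v w : MultipointPotential V} (h : v.SamePoints w) (a : ℂ) :
    pointMass (fun _ => a) v.y = pointMass (fun _ => a) w.y := by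
  obtain ⟨e, he⟩ := h.exists_equiv
  simp_rw [pointMass, ← he]
  exact e.sum_comp fun j => Finsupp.single (w.y j) a

theorem SamePoints.f322_eq {v w : MultipointPotential (EuclideanSpace ℝ (Fin 3))}
    (h : v.SamePoints w) : v.f322 = w.f322 := by
  obtain ⟨e, he⟩ := h.exists_equiv
  funext k l
  simp_rw [f322, ← he]
  rw [← e.sum_comp]
  refine Finset.sum_congr rfl fun j _ => ?_
  rw [← e.sum_comp]
  refine Finset.sum_congr rfl fun j' _ => ?_
  simp only [e.injective.eq_iff]

theorem same_of_pointMass_eq {v w : MultipointPotential V} {g : ℂ → ℂ}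
    (hg : Function.Injective g) (hv : ∀ j, g (v.α j) ≠ 0) (hw : ∀ j, g (w.α j) ≠ 0)
    (hm : pointMass (fun j => g (v.α j)) v.y = pointMass (fun j => g (w.α j)) w.y) :
    v.Same w :=
  (samePoints_of_pointMass_eq hv hw hm).same_of_pointMass_eq hg hm

end MultipointPotential

/-! ### Decay of the Hankel function -/

section Hankel

theorem norm_exp_I_mul_sin (r θ : ℝ) : ‖Complex.exp (Complex.I * (r * Real.sin θ : ℝ))‖ = 1 := by
  rw [mul_comm, Complex.norm_exp_ofReal_mul_I]

/-- Non-stationary phase: integrate by parts against `u = (i r cos θ)⁻¹`. Two boundary terms and an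
integral over a length at most `2`, all controlled by `1 / (r c²)`, add up to the factor `4`. -/
theorem norm_integral_exp_sin_le_of_cos_ge {r a c : ℝ} (hr : 0 < r) (ha : 0 ≤ a)
    (ha' : a ≤ Real.pi / 2) (hc : 0 < c) (hca : c ≤ Real.cos a) :
    ‖∫ θ in (0 : ℝ)..a, Complex.exp (Complex.I * (r * Real.sin θ : ℝ))‖ ≤ 4 / (r * c ^ 2) := by
  set v : ℝ → ℂ := fun θ => Complex.exp (Complex.I * (r * Real.sin θ : ℝ)) with hv
  set u : ℝ → ℂ := fun θ => (Complex.I * r * (Real.cos θ : ℂ))⁻¹ with hu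
  have hrc : (r : ℂ) ≠ 0 := by exact_mod_cast hr.ne'
  have hcos : ∀ θ ∈ Set.uIcc 0 a, c ≤ Real.cos θ := by
    intro θ hθ
    rw [Set.uIcc_of_le ha] at hθ
    exact hca.trans (Real.cos_le_cos_of_nonneg_of_le_pi hθ.1
      (by linarith [Real.pi_pos]) hθ.2)
  have hcos0 : ∀ θ ∈ Set.uIcc 0 a, (Real.cos θ : ℂ) ≠ 0 := fun θ hθ => by
    exact_mod_cast (hc.trans_le (hcos θ hθ)).ne'
  have hvd : ∀ θ : ℝ, HasDerivAt v (v θ * (Complex.I * (r * Real.cos θ : ℝ))) θ := fun θ =>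
    (((Real.hasDerivAt_sin θ).const_mul r).ofReal_comp.const_mul Complex.I).cexp
  have hud : ∀ θ ∈ Set.uIcc 0 a,
      HasDerivAt u (-(Complex.I * r * ((-Real.sin θ : ℝ) : ℂ)) /
        (Complex.I * r * (Real.cos θ : ℂ)) ^ 2) θ := fun θ hθ =>
    ((Real.hasDerivAt_cos θ).ofReal_comp.const_mul (Complex.I * r)).fun_inv
      (mul_ne_zero (mul_ne_zero Complex.I_ne_zero hrc) (hcos0 θ hθ))
  have hparts := intervalIntegral.integral_mul_deriv_eq_deriv_mul (u := u) (v := v) (a := 0)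
    (b := a) hud (fun θ _ => hvd θ)
    (by
      apply ContinuousOn.intervalIntegrable
      apply ContinuousOn.div (by fun_prop) (by fun_prop)
      intro θ hθ
      exact pow_ne_zero _ (mul_ne_zero (mul_ne_zero Complex.I_ne_zero hrc) (hcos0 θ hθ)))
    (by
      apply Continuous.intervalIntegrable
      fun_prop)
  have hl : ∫ θ in (0 : ℝ)..a, u θ * (v θ * (Complex.I * (r * Real.cos θ : ℝ)))
      = ∫ θ in (0 : ℝ)..a, v θ := by
    apply intervalIntegral.integral_congr
    intro θ hθ
    have := hcos0 θ hθ
    simp only [hu]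
    push_cast at this ⊢
    field_simp
  rw [hl] at hparts
  have hvn : ∀ θ, ‖v θ‖ = 1 := fun θ => norm_exp_I_mul_sin r θ
  have hc1 : c ≤ 1 := hca.trans (Real.cos_le_one a)
  have hub : ∀ θ ∈ Set.uIcc 0 a, ‖u θ * v θ‖ ≤ 1 / (r * c ^ 2) := by
    intro θ hθ
    rw [norm_mul, hvn, mul_one, norm_inv, norm_mul, norm_mul, Complex.norm_I, one_mul,
      Complex.norm_real, Complex.norm_real, Real.norm_of_nonneg hr.le,
      Real.norm_of_nonneg (hc.le.trans (hcos θ hθ)), ← one_div]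
    have h1 := hcos θ hθ
    have : c ^ 2 ≤ Real.cos θ := by nlinarith
    gcongr
  have hint : ‖∫ θ in (0 : ℝ)..a, (-(Complex.I * r * ((-Real.sin θ : ℝ) : ℂ)) /
        (Complex.I * r * (Real.cos θ : ℂ)) ^ 2) * v θ‖ ≤ 1 / (r * c ^ 2) * |a - 0| := by
    apply intervalIntegral.norm_integral_le_of_norm_le_const
    intro θ hθ
    have h1 := hcos θ (Set.uIoc_subset_uIcc hθ)
    rw [norm_mul, hvn, mul_one, norm_div, norm_pow, norm_neg, norm_mul, norm_mul, norm_mul,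
      norm_mul, Complex.norm_I, one_mul,
      Complex.norm_real, Complex.norm_real, Complex.norm_real, Real.norm_of_nonneg hr.le,
      Real.norm_of_nonneg (hc.le.trans h1), norm_neg, Real.norm_eq_abs]
    rw [div_le_div_iff₀ (by have := hc.trans_le h1; positivity) (by positivity)]
    have hs := Real.abs_sin_le_one θ
    have h2 : c ^ 2 ≤ Real.cos θ ^ 2 := by gcongr
    calc r * |Real.sin θ| * (r * c ^ 2) ≤ r * 1 * (r * Real.cos θ ^ 2) := by gcongr
      _ = 1 * (r * Real.cos θ) ^ 2 := by ring
  rw [hparts]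
  have h3 := norm_sub_le (u a * v a - u 0 * v 0) (∫ θ in (0 : ℝ)..a,
    (-(Complex.I * r * ((-Real.sin θ : ℝ) : ℂ)) / (Complex.I * r * (Real.cos θ : ℂ)) ^ 2) * v θ)
  have h4 := norm_sub_le (u a * v a) (u 0 * v 0)
  have h5 := hub a Set.right_mem_uIcc
  have h6 := hub 0 Set.left_mem_uIcc
  have h7 : |a - 0| ≤ 2 := by
    rw [sub_zero, abs_of_nonneg ha]; linarith [Real.pi_le_four]
  have h8 : 1 / (r * c ^ 2) * |a - 0| ≤ 1 / (r * c ^ 2) * 2 := by gcongr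
  have h9 : 4 / (r * c ^ 2) = 4 * (1 / (r * c ^ 2)) := by ring
  linarith

/-- The phase is stationary at `π/2`. A window of length `h` there is estimated trivially; on the
rest `cos θ ≥ sin h ≥ h/2` by Jordan's inequality. -/
theorem norm_integral_exp_sin_half_le {r h : ℝ} (hr : 0 < r) (hh : 0 < h) (hh' : h ≤ 1) :
    ‖∫ θ in (0 : ℝ)..(Real.pi / 2), Complex.exp (Complex.I * (r * Real.sin θ : ℝ))‖
      ≤ h + 16 / (r * h ^ 2) := by
  have hi : ∀ a b : ℝ, IntervalIntegrable
      (fun θ : ℝ => Complex.exp (Complex.I * (r * Real.sin θ : ℝ))) volume a b := fun a b =>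
    Continuous.intervalIntegrable (by fun_prop) _ _
  rw [← intervalIntegral.integral_add_adjacent_intervals (hi 0 (Real.pi / 2 - h)) (hi _ _)]
  have h1 : ‖∫ θ in (Real.pi / 2 - h)..(Real.pi / 2),
      Complex.exp (Complex.I * (r * Real.sin θ : ℝ))‖ ≤ 1 * |Real.pi / 2 - (Real.pi / 2 - h)| :=
    intervalIntegral.norm_integral_le_of_norm_le_const fun θ _ => (norm_exp_I_mul_sin r θ).le
  rw [sub_sub_cancel, abs_of_pos hh, one_mul] at h1
  have hs : h / 2 ≤ Real.cos (Real.pi / 2 - h) := by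
    rw [Real.cos_pi_div_two_sub]
    have := Real.mul_le_sin hh.le (by linarith [Real.pi_gt_three])
    refine le_trans ?_ this
    have : (1 : ℝ) / 2 ≤ 2 / Real.pi := by
      rw [div_le_div_iff₀ (by norm_num) Real.pi_pos]; linarith [Real.pi_le_four]
    nlinarith
  have h2 := norm_integral_exp_sin_le_of_cos_ge (c := h / 2) hr
    (by linarith [Real.pi_gt_three]) (by linarith) (by positivity) hs
  have h3 : 4 / (r * (h / 2) ^ 2) = 16 / (r * h ^ 2) := by field_simp; norm_num
  rw [h3] at h2
  exact (norm_add_le _ _).trans (by linarith)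

theorem integral_exp_sin_eq_two_mul (r : ℝ) :
    ∫ θ in (0 : ℝ)..Real.pi, Complex.exp (Complex.I * (r * Real.sin θ : ℝ))
      = 2 * ∫ θ in (0 : ℝ)..(Real.pi / 2), Complex.exp (Complex.I * (r * Real.sin θ : ℝ)) := by
  have hi : ∀ a b : ℝ, IntervalIntegrable
      (fun θ : ℝ => Complex.exp (Complex.I * (r * Real.sin θ : ℝ))) volume a b := fun a b =>
    Continuous.intervalIntegrable (by fun_prop) _ _
  rw [← intervalIntegral.integral_add_adjacent_intervals (hi 0 (Real.pi / 2)) (hi _ _), two_mul]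
  congr 1
  have := intervalIntegral.integral_comp_sub_left (a := 0) (b := Real.pi / 2)
    (fun θ : ℝ => Complex.exp (Complex.I * (r * Real.sin θ : ℝ))) Real.pi
  simp only [Real.sin_pi_sub, sub_zero] at this
  rw [this]
  congr 1
  ring

theorem integral_exp_neg_sinh_le {r : ℝ} (hr : 0 < r) :
    ‖∫ t in Set.Ioi (0 : ℝ), Real.exp (-(r * Real.sinh t))‖ ≤ r⁻¹ := by
  have hint := exp_neg_integrableOn_Ioi 0 hr
  have h := norm_integral_le_of_norm_le (μ := volume.restrict (Set.Ioi (0 : ℝ)))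
    (f := fun t => Real.exp (-(r * Real.sinh t))) hint (by
      filter_upwards [self_mem_ae_restrict measurableSet_Ioi] with t ht
      rw [Real.norm_of_nonneg (Real.exp_pos _).le, Real.exp_le_exp]
      have := Real.self_le_sinh_iff.2 (le_of_lt ht)
      nlinarith)
  refine h.trans (le_of_eq ?_)
  have := integral_exp_mul_Ioi (a := -r) (by linarith) 0
  simp only [mul_zero, Real.exp_zero] at this
  rw [this]
  simp

theorem hankelH0_eq (r : ℝ) : hankelH0 r = (Real.pi : ℂ)⁻¹ *
    (∫ θ in (0 : ℝ)..Real.pi, Complex.exp (Complex.I * (r * Real.sin θ : ℝ)))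
      - Complex.I * (2 * (Real.pi : ℂ)⁻¹ *
        ((∫ t in Set.Ioi (0 : ℝ), Real.exp (-(r * Real.sinh t)) : ℝ) : ℂ)) := by
  have h : ∫ θ in (0 : ℝ)..Real.pi, Complex.exp (Complex.I * (r * Real.sin θ : ℝ))
      = ((∫ θ in (0 : ℝ)..Real.pi, Real.cos (r * Real.sin θ) : ℝ) : ℂ)
        + ((∫ θ in (0 : ℝ)..Real.pi, Real.sin (r * Real.sin θ) : ℝ) : ℂ) * Complex.I := by
    rw [← intervalIntegral.integral_ofReal, ← intervalIntegral.integral_ofReal,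
      ← intervalIntegral.integral_mul_const, ← intervalIntegral.integral_add]
    · refine intervalIntegral.integral_congr fun θ _ => ?_
      rw [mul_comm, Complex.exp_mul_I, Complex.ofReal_cos, Complex.ofReal_sin]
    · exact Continuous.intervalIntegrable (by fun_prop) _ _
    · exact Continuous.intervalIntegrable (by fun_prop) _ _
  rw [h, hankelH0, besselJ0, besselY0]
  push_cast
  ring

/-- The choice `h = r^(-1/3)` balances `h` against `1 / (r h²)`. The exponent is not the sharp
`-1/2`, but any negative power suffices to beat `1 / log κ`. -/
theorem norm_hankelH0_le {r : ℝ} (hr : 1 ≤ r) : ‖hankelH0 r‖ ≤ 36 * r ^ (-(1 / 3) : ℝ) := by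
  have hr0 : 0 < r := one_pos.trans_le hr
  set h := r ^ (-(1 / 3) : ℝ) with hh
  have hpos : 0 < h := Real.rpow_pos_of_pos hr0 _
  have hle : h ≤ 1 := Real.rpow_le_one_of_one_le_of_nonpos hr (by norm_num)
  have h1 := norm_integral_exp_sin_half_le hr0 hpos hle
  have h2 : r * h ^ 2 = h⁻¹ := by
    rw [hh, ← Real.rpow_natCast, ← Real.rpow_mul hr0.le, ← Real.rpow_neg hr0.le]
    nth_rewrite 1 [← Real.rpow_one r]
    rw [← Real.rpow_add hr0]
    norm_num
  rw [h2, div_inv_eq_mul] at h1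
  have h3 : r⁻¹ ≤ h := by
    rw [← Real.rpow_neg_one]
    exact Real.rpow_le_rpow_of_exponent_le hr (by norm_num)
  have h4 := integral_exp_neg_sinh_le hr0
  have hpi : Real.pi⁻¹ ≤ 1 := inv_le_one_of_one_le₀ (by linarith [Real.pi_gt_three])
  rw [hankelH0_eq, integral_exp_sin_eq_two_mul]
  refine (norm_sub_le _ _).trans ?_
  simp only [norm_mul, norm_inv, Complex.norm_real, Complex.norm_I, Complex.norm_ofNat,
    Real.norm_of_nonneg Real.pi_pos.le] at h4 ⊢
  set a := ‖∫ θ in (0 : ℝ)..(Real.pi / 2), Complex.exp (Complex.I * (r * Real.sin θ : ℝ))‖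
  set b := ‖∫ t in Set.Ioi (0 : ℝ), Real.exp (-(r * Real.sinh t))‖
  -- `17 h = h + 16 h` bounds the oscillating half integral, and `b ≤ r⁻¹ ≤ h`; in total `34 h + 2
  -- h`.
  calc Real.pi⁻¹ * (2 * a) + 1 * (2 * Real.pi⁻¹ * b)
      ≤ 1 * (2 * (17 * h)) + 1 * (2 * 1 * h) := by
        gcongr
        · linarith
        · linarith
    _ = 36 * h := by ring

theorem hankelH0_mul_isBigO_inv_log {r : ℝ} (hr : 0 < r) :
    (fun κ : ℝ => hankelH0 (r * κ)) =O[atTop] fun κ : ℝ => (Real.log κ)⁻¹ := by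
  have h1 : (fun s : ℝ => hankelH0 s) =O[atTop] fun s : ℝ => s ^ (-(1 / 3) : ℝ) := by
    refine IsBigO.of_bound 36 ?_
    filter_upwards [eventually_ge_atTop 1] with s hs
    rw [Real.norm_of_nonneg (Real.rpow_nonneg (by linarith) _)]
    exact norm_hankelH0_le hs
  have h2 : (fun κ : ℝ => hankelH0 (r * κ)) =O[atTop] fun κ : ℝ => (r * κ) ^ (-(1 / 3) : ℝ) :=
    h1.comp_tendsto (tendsto_id.const_mul_atTop hr)
  have h3 : (fun κ : ℝ => (r * κ) ^ (-(1 / 3) : ℝ)) =O[atTop] fun κ : ℝ => (κ ^ (1 / 3 : ℝ))⁻¹ := by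
    refine IsBigO.of_bound (r ^ (-(1 / 3) : ℝ)) ?_
    filter_upwards [eventually_gt_atTop 0] with κ hκ
    rw [Real.mul_rpow hr.le hκ.le, Real.rpow_neg hκ.le, norm_mul,
      Real.norm_of_nonneg (Real.rpow_nonneg hr.le _)]
  have h4 : (fun κ : ℝ => (κ ^ (1 / 3 : ℝ))⁻¹) =O[atTop] fun κ : ℝ => (Real.log κ)⁻¹ := by
    refine (isLittleO_log_rpow_atTop (by norm_num : (0 : ℝ) < 1 / 3)).isBigO.inv_rev ?_
    filter_upwards [eventually_gt_atTop 1] with κ hκ h0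
    exact absurd h0 (Real.log_pos hκ).ne'
  exact h2.trans (h3.trans h4)

end Hankel

/-! ### Neumann expansion for a large scalar plus a bounded operator -/

section Perturbation

variable {E : Type*} [NormedAddCommGroup E] [NormedSpace ℂ E]

/-- Since `C ≤ ‖x‖ / 2`, the term `T q` is absorbed into half of `x • q`. -/
theorem norm_le_of_smul_add_eq {T : E →ₗ[ℂ] E} {C : ℝ} (hT : ∀ u, ‖T u‖ ≤ C * ‖u‖) {x : ℂ}
    (hx : 0 < ‖x‖) (hC : 2 * C ≤ ‖x‖) {q b : E} (h : x • q + T q = b) :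
    ‖q‖ ≤ 2 * ‖b‖ / ‖x‖ := by
  have h1 : ‖x‖ * ‖q‖ ≤ ‖b‖ + C * ‖q‖ := by
    rw [← norm_smul, eq_sub_of_add_eq h]
    exact (norm_sub_le _ _).trans (by gcongr; exact hT q)
  rw [le_div_iff₀ hx]
  nlinarith [norm_nonneg q]

theorem sub_inv_smul_eq_of_smul_add_eq {T : E →ₗ[ℂ] E} {x : ℂ} (hx : x ≠ 0) {q b : E}
    (h : x • q + T q = b) : q - x⁻¹ • b = -(x⁻¹ • T q) := by
  rw [← h, smul_add, inv_smul_smul₀ hx]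
  abel

theorem norm_sub_inv_smul_le_of_smul_add_eq {T : E →ₗ[ℂ] E} {C : ℝ} (hC0 : 0 ≤ C)
    (hT : ∀ u, ‖T u‖ ≤ C * ‖u‖) {x : ℂ}
    (hx : 0 < ‖x‖) (hC : 2 * C ≤ ‖x‖) {q b : E} (h : x • q + T q = b) :
    ‖q - x⁻¹ • b‖ ≤ 2 * C * ‖b‖ / ‖x‖ ^ 2 := by
  rw [sub_inv_smul_eq_of_smul_add_eq (norm_pos_iff.1 hx) h, norm_neg, norm_smul, norm_inv]
  calc ‖x‖⁻¹ * ‖T q‖ ≤ ‖x‖⁻¹ * (C * (2 * ‖b‖ / ‖x‖)) := by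
        gcongr
        exact (hT q).trans (by gcongr; exact norm_le_of_smul_add_eq hT hx hC h)
    _ = 2 * C * ‖b‖ / ‖x‖ ^ 2 := by field_simp

/-- Iterating `q = x⁻¹ b - x⁻¹ T q` once more leaves the remainder `-x⁻¹ T (q - x⁻¹ b)`, to which
the first-order bound applies. -/
theorem norm_sub_second_order_le_of_smul_add_eq {T : E →ₗ[ℂ] E} {C : ℝ} (hC0 : 0 ≤ C)
    (hT : ∀ u, ‖T u‖ ≤ C * ‖u‖) {x : ℂ}
    (hx : 0 < ‖x‖) (hC : 2 * C ≤ ‖x‖) {q b : E} (h : x • q + T q = b) :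
    ‖q - (x⁻¹ • b - (x ^ 2)⁻¹ • T b)‖ ≤ 2 * C ^ 2 * ‖b‖ / ‖x‖ ^ 3 := by
  have hx0 := norm_pos_iff.1 hx
  have h1 : q - (x⁻¹ • b - (x ^ 2)⁻¹ • T b) = -(x⁻¹ • T (q - x⁻¹ • b)) := by
    have h2 := sub_inv_smul_eq_of_smul_add_eq hx0 h
    rw [map_sub, map_smul, smul_sub, smul_smul, ← mul_inv, ← pow_two, neg_sub, ← sub_add, h2]
    abel
  rw [h1, norm_neg, norm_smul, norm_inv]
  calc ‖x‖⁻¹ * ‖T (q - x⁻¹ • b)‖ ≤ ‖x‖⁻¹ * (C * (2 * C * ‖b‖ / ‖x‖ ^ 2)) := by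
        gcongr
        exact (hT _).trans
          (by gcongr; exact norm_sub_inv_smul_le_of_smul_add_eq hC0 hT hx hC h)
    _ = 2 * C ^ 2 * ‖b‖ / ‖x‖ ^ 3 := by field_simp

theorem norm_mulVec_le {n : ℕ} {M : Matrix (Fin n) (Fin n) ℂ} {m : ℝ} (hm : 0 ≤ m)
    (hM : ∀ i j, ‖M i j‖ ≤ m) (u : Fin n → ℂ) : ‖M.mulVec u‖ ≤ n * m * ‖u‖ := by
  rw [pi_norm_le_iff_of_nonneg (by positivity)]
  intro i
  rw [Matrix.mulVec, dotProduct]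
  refine (norm_sum_le _ _).trans ?_
  calc ∑ j, ‖M i j * u j‖ ≤ ∑ _j : Fin n, m * ‖u‖ := by
        gcongr with j
        rw [norm_mul]
        gcongr
        · exact hM i j
        · exact norm_le_pi_norm u j
    _ = n * m * ‖u‖ := by simp [mul_assoc]

/-- The a priori bound with `b = 0` forces the kernel to be trivial. -/
theorem isUnit_det_smul_one_add {n : ℕ} {M : Matrix (Fin n) (Fin n) ℂ} {m : ℝ} (hm : 0 ≤ m)
    (hM : ∀ i j, ‖M i j‖ ≤ m) {x : ℂ} (hx : 0 < ‖x‖) (hC : 2 * (n * m) ≤ ‖x‖) :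
    IsUnit (x • (1 : Matrix (Fin n) (Fin n) ℂ) + M).det := by
  rw [isUnit_iff_ne_zero]
  intro h0
  obtain ⟨q, hq, hq0⟩ := Matrix.exists_mulVec_eq_zero_iff.2 h0
  rw [Matrix.add_mulVec, Matrix.smul_mulVec, Matrix.one_mulVec] at hq0
  have := norm_le_of_smul_add_eq (T := M.mulVecLin) (norm_mulVec_le hm hM) hx hC hq0
  simp at this
  exact hq this

end Perturbation

/-! ### Second-order expansion of the amplitude -/

namespace MultipointPotential

variable {V : Type*} [NormedAddCommGroup V] [InnerProductSpace ℝ V]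

/-- The off-diagonal part of `A(κ)`. -/
def offDiagonal (v : MultipointPotential V) (κ : ℝ) : Matrix (Fin v.n) (Fin v.n) ℂ :=
  Matrix.of fun i j => if i = j then 0 else greenPlus (v.y i - v.y j) κ

theorem matrixA_eq (v : MultipointPotential V) (κ : ℝ) :
    v.matrixA κ = Matrix.diagonal (fun j => diagonalEntry (Module.finrank ℝ V) (v.α j) κ)
      + v.offDiagonal κ := by
  ext i j
  by_cases h : i = j
  · subst h; simp [matrixA, offDiagonal]
  · simp [matrixA, offDiagonal, h]

theorem norm_vectorB_apply (v : MultipointPotential V) (k : V) (j : Fin v.n) :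
    ‖v.vectorB k j‖ = 1 := by
  rw [vectorB, norm_neg, mul_comm, Complex.norm_exp_ofReal_mul_I]

theorem norm_vectorB_le (v : MultipointPotential V) (k : V) : ‖v.vectorB k‖ ≤ 1 :=
  (pi_norm_le_iff_of_nonneg zero_le_one).2 fun j => (v.norm_vectorB_apply k j).le

theorem matrixA_mulVec_chargeQ (v : MultipointPotential V) {k : V} (h : v.SolvableAt ‖k‖) :
    (v.matrixA ‖k‖).mulVec (v.chargeQ k) = v.vectorB k := by
  rw [chargeQ, Matrix.mulVec_mulVec, Matrix.mul_nonsing_inv _ h, Matrix.one_mulVec]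

/-- This is where momentum transfer enters: with `k - l` fixed, the phase at a single point no
longer depends on the energy. -/
theorem vectorB_mul_exp (v : MultipointPotential V) {k l p : V} (h : k - l = p) (j : Fin v.n) :
    v.vectorB k j * Complex.exp (-(Complex.I * (inner ℝ l (v.y j) : ℝ)))
      = -Complex.exp (Complex.I * (inner ℝ p (v.y j) : ℝ)) := by
  rw [vectorB, neg_mul, ← Complex.exp_add, ← h, inner_sub_left]
  push_cast
  ring_nf

section Asymptotics

variable {ι : Type*} {f : Filter ι}

theorem exists_bound_offDiagonal (v : MultipointPotential V) {κ : ι → ℝ}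
    (hG : ∀ i j, i ≠ j → (fun t => greenPlus (v.y i - v.y j) (κ t)) =O[f] fun _ => (1 : ℝ))
    (β : Fin v.n → ℂ) :
    ∃ m : ℝ, 0 ≤ m ∧ ∀ᶠ t in f, ∀ i j,
      ‖(Matrix.diagonal β + v.offDiagonal (κ t)) i j‖ ≤ m := by
  have h : ∀ i j, ∃ m : ℝ, ∀ᶠ t in f, ‖(Matrix.diagonal β + v.offDiagonal (κ t)) i j‖ ≤ m := by
    intro i j
    by_cases hij : i = j
    · exact ⟨‖β i‖, .of_forall fun t => by subst hij; simp [offDiagonal]⟩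
    · obtain ⟨m, hm⟩ := (hG i j hij).bound
      refine ⟨m, hm.mono fun t ht => ?_⟩
      simpa [offDiagonal, hij] using ht
  choose m hm using h
  refine ⟨∑ i, ∑ j, |m i j|, by positivity, ?_⟩
  filter_upwards [eventually_all.2 fun i => eventually_all.2 (hm i)] with t ht i j
  calc _ ≤ m i j := ht i j
    _ ≤ |m i j| := le_abs_self _
    _ ≤ ∑ j, |m i j| := Finset.single_le_sum (f := fun j => |m i j|)
        (fun _ _ => abs_nonneg _) (Finset.mem_univ j)
    _ ≤ _ := Finset.single_le_sum (f := fun i => ∑ j, |m i j|)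
        (fun _ _ => by positivity) (Finset.mem_univ i)

theorem eventually_solvableAt (v : MultipointPotential V) {κ : ι → ℝ} {x : ι → ℂ}
    {β : Fin v.n → ℂ} (hx : Tendsto (fun t => ‖x t‖) f atTop)
    (hd : ∀ᶠ t in f, ∀ j, diagonalEntry (Module.finrank ℝ V) (v.α j) (κ t) = x t + β j)
    (hG : ∀ i j, i ≠ j → (fun t => greenPlus (v.y i - v.y j) (κ t)) =O[f] fun _ => (1 : ℝ)) :
    ∀ᶠ t in f, v.SolvableAt (κ t) := by
  obtain ⟨m, hm0, hm⟩ := v.exists_bound_offDiagonal hG β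
  filter_upwards [hm, hd, hx.eventually_ge_atTop (2 * (v.n * m)), hx.eventually_gt_atTop 0]
    with t hmt hdt hxt hxt0
  have hA : v.matrixA (κ t) = x t • (1 : Matrix (Fin v.n) (Fin v.n) ℂ) +
      (Matrix.diagonal β + v.offDiagonal (κ t)) := by
    rw [matrixA_eq, ← add_assoc, Matrix.smul_one_eq_diagonal, Matrix.diagonal_add]
    simp_rw [hdt]
  rw [SolvableAt, hA]
  exact isUnit_det_smul_one_add hm0 hmt hxt0 hxt

/-- The matrix is split as `x • 1 + (diagonal β + offDiagonal)`: `x` is the growing part common to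
all diagonal entries and `β` the constant part. Dimensions two and three differ only in `x`, `β` and
the size of the off-diagonal entries. -/
theorem amplitude_sub_isBigO (v : MultipointPotential V) {k l : ι → V} {x : ι → ℂ}
    {β : Fin v.n → ℂ} (hx : Tendsto (fun t => ‖x t‖) f atTop)
    (hd : ∀ᶠ t in f, ∀ j, diagonalEntry (Module.finrank ℝ V) (v.α j) ‖k t‖ = x t + β j)
    (hG : ∀ i j, i ≠ j → (fun t => greenPlus (v.y i - v.y j) ‖k t‖) =O[f] fun _ => (1 : ℝ)) :
    (fun t => v.amplitude (k t) (l t) - ((2 * Real.pi : ℂ) ^ Module.finrank ℝ V)⁻¹ *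
      ∑ j, ((x t)⁻¹ * v.vectorB (k t) j - (x t ^ 2)⁻¹ * (β j * v.vectorB (k t) j +
        (v.offDiagonal ‖k t‖).mulVec (v.vectorB (k t)) j)) *
          Complex.exp (-(Complex.I * (inner ℝ (l t) (v.y j) : ℝ)))) =O[f]
      fun t => (x t ^ 3)⁻¹ := by
  obtain ⟨m, hm0, hm⟩ := v.exists_bound_offDiagonal hG β
  refine IsBigO.of_bound (‖((2 * Real.pi : ℂ) ^ Module.finrank ℝ V)⁻¹‖ *
    (v.n * (2 * (v.n * m) ^ 2))) ?_
  filter_upwards [hm, hd, hx.eventually_ge_atTop (2 * (v.n * m)), hx.eventually_gt_atTop 0,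
    v.eventually_solvableAt hx hd hG] with t hmt hdt hxt hxt0 hs
  have hA : v.matrixA ‖k t‖ = x t • (1 : Matrix (Fin v.n) (Fin v.n) ℂ) +
      (Matrix.diagonal β + v.offDiagonal ‖k t‖) := by
    rw [matrixA_eq, ← add_assoc, Matrix.smul_one_eq_diagonal, Matrix.diagonal_add]
    simp_rw [hdt]
  have hq := v.matrixA_mulVec_chargeQ hs
  rw [hA, Matrix.add_mulVec, Matrix.smul_mulVec, Matrix.one_mulVec] at hq
  have hb := norm_sub_second_order_le_of_smul_add_eq
    (T := (Matrix.diagonal β + v.offDiagonal ‖k t‖).mulVecLin) (by positivity)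
    (norm_mulVec_le hm0 hmt) hxt0 hxt hq
  rw [amplitude, ← mul_sub, ← Finset.sum_sub_distrib, norm_mul, mul_assoc]
  refine mul_le_mul_of_nonneg_left ?_ (norm_nonneg _)
  refine (norm_sum_le _ _).trans ?_
  have hb1 := v.norm_vectorB_le (k t)
  calc _ ≤ ∑ _j : Fin v.n, 2 * (v.n * m) ^ 2 * ‖(x t ^ 3)⁻¹‖ := by
        refine Finset.sum_le_sum fun j _ => ?_
        rw [← sub_mul, norm_mul, mul_comm Complex.I, ← neg_mul, ← Complex.ofReal_neg,
          Complex.norm_exp_ofReal_mul_I, mul_one]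
        refine le_trans (le_of_eq ?_) ((norm_le_pi_norm _ j).trans (hb.trans ?_))
        · simp [Matrix.mulVec_diagonal, mul_add]
        · rw [norm_inv, norm_pow, div_eq_mul_inv]
          exact mul_le_mul_of_nonneg_right (mul_le_of_le_one_right (by positivity) hb1)
            (by positivity)
    _ = _ := by simp [mul_assoc]

end Asymptotics

end MultipointPotential

/-! ### Reading coefficients off an expansion -/

section Expansion

variable {ι : Type*} {f : Filter ι} {F c : ι → ℂ} {L : ι → ℝ} {a : ℂ}

theorem isBigO_inv_pow_three_mul (hL : Tendsto L f atTop) {R : ι → ℂ}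
    (h : R =O[f] fun t => (L t ^ 3)⁻¹) {n : ℕ} (hn : n < 3) :
    Tendsto (fun t => (L t : ℂ) ^ n * R t) f (𝓝 0) := by
  have h1 : (fun t => (L t : ℂ) ^ n * R t) =O[f] fun t => L t ^ n * (L t ^ 3)⁻¹ :=
    (IsBigO.of_bound 1 (.of_forall fun t => by simp)).mul h
  refine h1.trans_tendsto ?_
  have h2 : Tendsto (fun t => (L t ^ (3 - n))⁻¹) f (𝓝 0) :=
    ((tendsto_pow_atTop (by lia)).comp hL).inv_tendsto_atTop
  refine h2.congr' ?_
  filter_upwards [hL.eventually_gt_atTop 0] with t ht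
  rw [eq_mul_inv_iff_mul_eq₀ (by positivity), inv_mul_eq_iff_eq_mul₀ (by positivity), ← pow_add]
  congr 1
  lia

/-- The coefficient `c` may vary with `t`, because in dimension three it contains the oscillating
`f₃,₂²`; hence the limit is stated for the difference. -/
theorem tendsto_second_coefficient (hL : Tendsto L f atTop)
    (h : (fun t => F t - (a / (L t : ℂ) + c t / (L t : ℂ) ^ 2)) =O[f] fun t => (L t ^ 3)⁻¹) :
    Tendsto (fun t => (L t : ℂ) ^ 2 * (F t - a / (L t : ℂ)) - c t) f (𝓝 0) := by
  refine (isBigO_inv_pow_three_mul hL h (n := 2) (by norm_num)).congr' ?_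
  filter_upwards [hL.eventually_gt_atTop 0] with t ht
  have : (L t : ℂ) ≠ 0 := by exact_mod_cast ht.ne'
  field_simp
  ring

theorem tendsto_first_coefficient (hL : Tendsto L f atTop) (hc : c =O[f] fun _ => (1 : ℝ))
    (h : (fun t => F t - (a / (L t : ℂ) + c t / (L t : ℂ) ^ 2)) =O[f] fun t => (L t ^ 3)⁻¹) :
    Tendsto (fun t => (L t : ℂ) * F t) f (𝓝 a) := by
  have h1 := isBigO_inv_pow_three_mul hL h (n := 1) (by norm_num)
  have h2 : Tendsto (fun t => c t * (L t : ℂ)⁻¹) f (𝓝 0) := by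
    have : (fun t => c t * (L t : ℂ)⁻¹) =O[f] fun t => 1 * (L t)⁻¹ :=
      hc.mul (IsBigO.of_bound 1 (.of_forall fun t => by simp))
    refine this.trans_tendsto ?_
    simpa [Pi.inv_def] using hL.inv_tendsto_atTop
  have h3 := (h1.add h2).add_const a
  rw [add_zero, zero_add] at h3
  refine h3.congr' ?_
  filter_upwards [hL.eventually_gt_atTop 0] with t ht
  have : (L t : ℂ) ≠ 0 := by exact_mod_cast ht.ne'
  field_simp
  ring

end Expansion

/-! ### The momenta `k_E(p)` and `l_E(p)` -/

section Parametrization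

variable {V : Type*} [NormedAddCommGroup V] [InnerProductSpace ℝ V] {γ : V → V}

theorem kE_sub_lE (γ : V → V) (E : ℝ) (p : V) : kE γ E p - lE γ E p = p := by
  rw [kE, lE, add_sub_add_right_eq_sub, sub_neg_eq_add, ← add_smul]
  norm_num

theorem norm_kE (hγ : IsUnitTransverse γ) {E : ℝ} {p : V} (hE : ‖p‖ ^ 2 / 4 ≤ E) :
    ‖kE γ E p‖ = √E := by
  rw [eq_comm, Real.sqrt_eq_iff_mul_self_eq (by nlinarith [sq_nonneg ‖p‖]) (norm_nonneg _), kE,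
    norm_add_mul_self_real, norm_smul, norm_smul, (hγ p).1, real_inner_smul_left,
    real_inner_smul_right, real_inner_comm, (hγ p).2, Real.norm_of_nonneg (Real.sqrt_nonneg _)]
  have := Real.mul_self_sqrt (sub_nonneg.2 hE)
  norm_num
  linarith

theorem eventually_norm_kE (hγ : IsUnitTransverse γ) (p : V) :
    ∀ᶠ E in atTop, ‖kE γ E p‖ = √E :=
  (eventually_ge_atTop (‖p‖ ^ 2 / 4)).mono fun _ => norm_kE hγ

end Parametrization

theorem isBigO_one_exp_I_mul_ofReal {ι : Type*} (f : Filter ι) (u : ι → ℝ) :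
    (fun t => Complex.exp (Complex.I * (u t : ℂ))) =O[f] fun _ => (1 : ℝ) :=
  IsBigO.of_bound 1 (.of_forall fun t => by rw [mul_comm, Complex.norm_exp_ofReal_mul_I]; simp)

namespace MultipointPotential

/-! ### Expansion in dimension two -/

section Two

theorem greenPlus_two (x : EuclideanSpace ℝ (Fin 2)) (κ : ℝ) :
    greenPlus x κ = -(Complex.I / 4) * hankelH0 (‖x‖ * κ) := by
  rw [greenPlus, finrank_euclideanSpace_fin]
  rfl

/-- The shift `i/4 = (4π)⁻¹ π i` in the bounded part is the source of the exceptional strength. -/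
theorem diagonalEntry_two (α : ℂ) (κ : ℝ) :
    diagonalEntry 2 α κ = (Real.log κ / (2 * Real.pi) : ℝ) + (α - Complex.I / 4) := by
  have := Real.pi_ne_zero
  rw [diagonalEntry]
  push_cast
  field_simp
  ring

theorem greenPlus_two_isBigO {x : EuclideanSpace ℝ (Fin 2)} (hx : x ≠ 0) :
    (fun κ : ℝ => greenPlus x κ) =O[atTop] fun κ : ℝ => (Real.log κ)⁻¹ := by
  simp_rw [greenPlus_two]
  exact (hankelH0_mul_isBigO_inv_log (norm_pos_iff.2 hx)).const_mul_left _

theorem greenPlus_two_isBigO_one {x : EuclideanSpace ℝ (Fin 2)} (hx : x ≠ 0) :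
    (fun κ : ℝ => greenPlus x κ) =O[atTop] fun _ => (1 : ℝ) :=
  (greenPlus_two_isBigO hx).trans (Real.tendsto_log_atTop.inv_tendsto_atTop.isBigO_one ℝ)

variable (v : MultipointPotential (EuclideanSpace ℝ (Fin 2)))

theorem tendsto_norm_log_div : Tendsto
    (fun κ : ℝ => ‖((Real.log κ / (2 * Real.pi) : ℝ) : ℂ)‖) atTop atTop := by
  simp_rw [Complex.norm_real]
  exact tendsto_norm_atTop_atTop.comp
    (Real.tendsto_log_atTop.atTop_div_const (by positivity))

theorem eventually_solvableAt_two : ∀ᶠ κ in atTop, v.SolvableAt κ :=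
  v.eventually_solvableAt (κ := id) tendsto_norm_log_div
    (β := fun j => v.α j - Complex.I / 4)
    (.of_forall fun κ j => by rw [finrank_euclideanSpace_fin, diagonalEntry_two]; rfl)
    fun _ _ hij => greenPlus_two_isBigO_one (sub_ne_zero.2 (v.y_injective.ne hij))

theorem amplitude_two_expansion {k l : ℝ → EuclideanSpace ℝ (Fin 2)}
    {p : EuclideanSpace ℝ (Fin 2)} (hk : ∀ᶠ E in atTop, ‖k E‖ = √E) (hkl : ∀ E, k E - l E = p) :
    (fun E : ℝ => v.amplitude (k E) (l E) - (fourierOfMeasure v.v21 p / (Real.log √E : ℂ)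
        + fourierOfMeasure v.v22 p / (Real.log √E : ℂ) ^ 2))
      =O[atTop] fun E : ℝ => (Real.log √E ^ 3)⁻¹ := by
  have hk' : Tendsto (fun E => ‖k E‖) atTop atTop :=
    Real.tendsto_sqrt_atTop.congr' (hk.mono fun _ h => h.symm)
  have hL : Tendsto (fun E => Real.log ‖k E‖) atTop atTop := Real.tendsto_log_atTop.comp hk'
  have hG : ∀ i j, i ≠ j → (fun E => greenPlus (v.y i - v.y j) ‖k E‖) =O[atTop]
      fun E => (Real.log ‖k E‖)⁻¹ := fun i j hij =>
    (greenPlus_two_isBigO (sub_ne_zero.2 (v.y_injective.ne hij))).comp_tendsto hk'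
  have hmain := v.amplitude_sub_isBigO (k := k) (l := l) (tendsto_norm_log_div.comp hk')
    (β := fun j => v.α j - Complex.I / 4)
    (.of_forall fun E j => by
      rw [finrank_euclideanSpace_fin, diagonalEntry_two])
    fun i j hij => (greenPlus_two_isBigO_one
      (sub_ne_zero.2 (v.y_injective.ne hij))).comp_tendsto hk'
  have hL3 : (fun E => (((Real.log ‖k E‖ / (2 * Real.pi) : ℝ) : ℂ) ^ 3)⁻¹) =O[atTop]
      fun E => (Real.log ‖k E‖ ^ 3)⁻¹ := by
    refine IsBigO.of_bound ((2 * Real.pi) ^ 3) (.of_forall fun E => le_of_eq ?_)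
    rw [norm_inv, norm_inv, norm_pow, norm_pow, Complex.norm_real, norm_div, Real.norm_of_nonneg
      (by positivity : 0 ≤ 2 * Real.pi), div_pow, inv_div, div_eq_mul_inv]
  -- The off-diagonal part of the second-order term is `x⁻²` times a decaying Green function, hence
  -- already of remainder size.
  have hrest : (fun E => ((2 * Real.pi : ℂ) ^ 2)⁻¹ * ∑ j,
      ((((Real.log ‖k E‖ / (2 * Real.pi) : ℝ) : ℂ) ^ 2)⁻¹ *
        (v.offDiagonal ‖k E‖).mulVec (v.vectorB (k E)) j) *
        Complex.exp (-(Complex.I * (inner ℝ (l E) (v.y j) : ℝ)))) =O[atTop]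
      fun E => (Real.log ‖k E‖ ^ 3)⁻¹ := by
    refine (IsBigO.fun_sum fun j _ => ?_).const_mul_left _
    have h1 : (fun E => (((Real.log ‖k E‖ / (2 * Real.pi) : ℝ) : ℂ) ^ 2)⁻¹) =O[atTop]
        fun E => (Real.log ‖k E‖ ^ 2)⁻¹ := by
      refine IsBigO.of_bound ((2 * Real.pi) ^ 2) (.of_forall fun E => le_of_eq ?_)
      rw [norm_inv, norm_inv, norm_pow, norm_pow, Complex.norm_real, norm_div, Real.norm_of_nonneg
        (by positivity : 0 ≤ 2 * Real.pi), div_pow, inv_div, div_eq_mul_inv]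
    have h2 : (fun E => (v.offDiagonal ‖k E‖).mulVec (v.vectorB (k E)) j) =O[atTop]
        fun E => (Real.log ‖k E‖)⁻¹ := by
      simp_rw [Matrix.mulVec, dotProduct]
      refine IsBigO.fun_sum fun i _ => ?_
      by_cases hij : j = i
      · simp only [offDiagonal, Matrix.of_apply, if_pos hij, zero_mul]
        exact isBigO_zero _ _
      · simp only [offDiagonal, Matrix.of_apply, if_neg hij]
        simpa using (hG j i hij).mul (IsBigO.of_bound 1 (.of_forall fun E => by
          rw [v.norm_vectorB_apply]; simp) : (fun E => v.vectorB (k E) i) =O[atTop]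
            fun _ => (1 : ℝ))
    have h3 : (fun E => Complex.exp (-(Complex.I * (inner ℝ (l E) (v.y j) : ℝ)))) =O[atTop]
        fun _ => (1 : ℝ) := by
      simpa using isBigO_one_exp_I_mul_ofReal atTop fun E => -inner ℝ (l E) (v.y j)
    refine ((h1.mul h2).mul h3).congr_right fun E => ?_
    rw [mul_one, ← mul_inv, ← pow_succ]
  have htot := (hmain.trans hL3).sub hrest
  refine htot.congr' ?_ ?_
  · filter_upwards [hk, hL.eventually_gt_atTop 0] with E hE hpos
    rw [hE] at hpos ⊢
    have hlog : (Real.log √E : ℂ) ≠ 0 := by exact_mod_cast hpos.ne'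
    have hpi : (Real.pi : ℂ) ≠ 0 := by exact_mod_cast Real.pi_ne_zero
    rw [v21, v22, fourierOfMeasure_discreteMeasure, fourierOfMeasure_discreteMeasure,
      finrank_euclideanSpace_fin, sub_sub]
    congr 1
    rw [← mul_add, ← Finset.sum_add_distrib, mul_div_assoc, mul_div_assoc, ← mul_add,
      Finset.sum_div, Finset.sum_div, ← Finset.sum_add_distrib]
    congr 1
    refine Finset.sum_congr rfl fun j _ => ?_
    have h := v.vectorB_mul_exp (hkl E) j
    push_cast
    field_simp
    linear_combination
      (8 * (Real.log √E : ℂ) - 16 * Real.pi * v.α j + 4 * Real.pi * Complex.I) * h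
  · filter_upwards [hk] with E hE
    rw [hE]

end Two

/-! ### Expansion in dimension three -/

section Three

theorem greenPlus_three (x : EuclideanSpace ℝ (Fin 3)) (κ : ℝ) :
    greenPlus x κ = -(Complex.exp (Complex.I * κ * ‖x‖) / (4 * Real.pi * ‖x‖)) := by
  rw [greenPlus, finrank_euclideanSpace_fin]
  rfl

theorem diagonalEntry_three (α : ℂ) (κ : ℝ) :
    diagonalEntry 3 α κ = -(Complex.I * κ / (4 * Real.pi)) + α := by
  rw [diagonalEntry]
  ring

theorem norm_greenPlus_three (x : EuclideanSpace ℝ (Fin 3)) (κ : ℝ) :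
    ‖greenPlus x κ‖ = (4 * Real.pi * ‖x‖)⁻¹ := by
  rw [greenPlus_three, norm_neg, norm_div, mul_assoc, mul_comm Complex.I, ← Complex.ofReal_mul,
    Complex.norm_exp_ofReal_mul_I, one_div]
  simp [abs_of_pos Real.pi_pos]

theorem greenPlus_three_isBigO {ι : Type*} (f : Filter ι) (κ : ι → ℝ)
    (x : EuclideanSpace ℝ (Fin 3)) : (fun t => greenPlus x (κ t)) =O[f] fun _ => (1 : ℝ) :=
  IsBigO.of_bound (4 * Real.pi * ‖x‖)⁻¹ (.of_forall fun t => by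
    rw [norm_greenPlus_three]; simp)

theorem norm_I_mul_div (κ : ℝ) :
    ‖-(Complex.I * κ / (4 * Real.pi : ℂ))‖ = |κ| / (4 * Real.pi) := by
  simp [abs_of_pos Real.pi_pos]

theorem tendsto_norm_I_mul_div : Tendsto
    (fun κ : ℝ => ‖-(Complex.I * κ / (4 * Real.pi : ℂ))‖) atTop atTop := by
  simp_rw [norm_I_mul_div]
  exact tendsto_abs_atTop_atTop.atTop_div_const (by positivity)

variable (v : MultipointPotential (EuclideanSpace ℝ (Fin 3)))

theorem eventually_solvableAt_three : ∀ᶠ κ in atTop, v.SolvableAt κ :=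
  v.eventually_solvableAt (κ := id) tendsto_norm_I_mul_div (β := v.α)
    (.of_forall fun κ j => by rw [finrank_euclideanSpace_fin, diagonalEntry_three]; rfl)
    fun _ _ _ => greenPlus_three_isBigO _ _ _

theorem f322_isBigO {ι : Type*} (f : Filter ι) (k l : ι → EuclideanSpace ℝ (Fin 3)) :
    (fun t => v.f322 (k t) (l t)) =O[f] fun _ => (1 : ℝ) := by
  refine IsBigO.fun_sum fun j _ => IsBigO.fun_sum fun j' _ => ?_
  by_cases hij : j = j'
  · simp only [if_pos hij]
    exact isBigO_zero _ _
  · simp only [if_neg hij]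
    have h1 : (fun t => Complex.exp (Complex.I * ‖k t‖ * ‖v.y j - v.y j'‖)
        / (2 * (Real.pi : ℂ) ^ 2 * ‖v.y j - v.y j'‖)) =O[f] fun _ => (1 : ℝ) := by
      simp_rw [div_eq_inv_mul]
      refine IsBigO.const_mul_left ?_ _
      simpa [mul_assoc] using isBigO_one_exp_I_mul_ofReal f fun t => ‖k t‖ * ‖v.y j - v.y j'‖
    have h2 : (fun t => Complex.exp (Complex.I * ((inner ℝ (k t) (v.y j) : ℝ)
        - (inner ℝ (l t) (v.y j') : ℝ)))) =O[f] fun _ => (1 : ℝ) := by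
      simpa using isBigO_one_exp_I_mul_ofReal f
        fun t => inner ℝ (k t) (v.y j) - inner ℝ (l t) (v.y j')
    simpa using h1.mul h2

/-- The roles of row and column are exchanged: `k` is paired with the column index. The two minus
signs, of `G⁺` and of `b`, cancel, and `1 / 4π = (π / 2) · (1 / 2π²)`. -/
theorem sum_offDiagonal_mulVec_eq_f322 (k l : EuclideanSpace ℝ (Fin 3)) :
    ∑ j, (v.offDiagonal ‖k‖).mulVec (v.vectorB k) j *
      Complex.exp (-(Complex.I * (inner ℝ l (v.y j) : ℝ))) = Real.pi / 2 * v.f322 k l := by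
  have hpi : (Real.pi : ℂ) ≠ 0 := by exact_mod_cast Real.pi_ne_zero
  simp_rw [f322, Matrix.mulVec, dotProduct, Finset.sum_mul, Finset.mul_sum]
  rw [Finset.sum_comm]
  refine Finset.sum_congr rfl fun i _ => Finset.sum_congr rfl fun j _ => ?_
  by_cases hij : i = j
  · simp [offDiagonal, hij]
  · have hexp : Complex.exp (Complex.I * ((inner ℝ k (v.y i) : ℝ) - (inner ℝ l (v.y j) : ℝ)))
        = Complex.exp (Complex.I * (inner ℝ k (v.y i) : ℝ)) *
          Complex.exp (-(Complex.I * (inner ℝ l (v.y j) : ℝ))) := by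
      rw [← Complex.exp_add]; ring_nf
    rw [if_neg hij, offDiagonal, Matrix.of_apply, if_neg (Ne.symm hij), greenPlus_three, vectorB,
      norm_sub_rev, hexp]
    have : (‖v.y i - v.y j‖ : ℂ) ≠ 0 := by
      exact_mod_cast (norm_pos_iff.2 (sub_ne_zero.2 (v.y_injective.ne hij))).ne'
    field_simp
    ring

theorem amplitude_three_expansion {k l : ℝ → EuclideanSpace ℝ (Fin 3)}
    {p : EuclideanSpace ℝ (Fin 3)} (hk : ∀ᶠ E in atTop, ‖k E‖ = √E) (hkl : ∀ E, k E - l E = p) :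
    (fun E : ℝ => v.amplitude (k E) (l E) - (fourierOfMeasure v.v31 p / (√E : ℂ)
        + (fourierOfMeasure v.v321 p + v.f322 (k E) (l E)) / (√E : ℂ) ^ 2))
      =O[atTop] fun E : ℝ => (√E ^ 3)⁻¹ := by
  have hk' : Tendsto (fun E => ‖k E‖) atTop atTop :=
    Real.tendsto_sqrt_atTop.congr' (hk.mono fun _ h => h.symm)
  have hmain := v.amplitude_sub_isBigO (k := k) (l := l) (tendsto_norm_I_mul_div.comp hk')
    (β := v.α)
    (.of_forall fun E j => by
      rw [finrank_euclideanSpace_fin, diagonalEntry_three])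
    fun i j hij => greenPlus_three_isBigO _ _ _
  have hL3 : (fun E => ((-(Complex.I * ‖k E‖ / (4 * Real.pi : ℂ))) ^ 3)⁻¹) =O[atTop]
      fun E => (‖k E‖ ^ 3)⁻¹ := by
    refine IsBigO.of_bound ((4 * Real.pi) ^ 3) (.of_forall fun E => le_of_eq ?_)
    rw [norm_inv, norm_inv, norm_pow, norm_pow, norm_I_mul_div, div_pow, inv_div, div_eq_mul_inv,
      Real.norm_eq_abs]
  refine (hmain.trans hL3).congr' ?_ ?_
  · filter_upwards [hk, hk'.eventually_gt_atTop 0] with E hE hpos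
    have hf := v.sum_offDiagonal_mulVec_eq_f322 (k E) (l E)
    rw [hE] at hpos hf ⊢
    have hs : (√E : ℂ) ≠ 0 := by exact_mod_cast hpos.ne'
    have hpi : (Real.pi : ℂ) ≠ 0 := by exact_mod_cast Real.pi_ne_zero
    have hff : v.f322 (k E) (l E) = 2 / Real.pi * ∑ j, (v.offDiagonal √E).mulVec
        (v.vectorB (k E)) j * Complex.exp (-(Complex.I * (inner ℝ (l E) (v.y j) : ℝ))) := by
      rw [hf]; field_simp
    -- `2 / π = (2π)⁻³ · 16π²`, which puts `f₃,₂²` under the same prefactor as the Fourier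
    -- transforms.
    have hff' : v.f322 (k E) (l E) = ((2 * Real.pi : ℂ) ^ 3)⁻¹ * ∑ j, 16 * (Real.pi : ℂ) ^ 2 *
        ((v.offDiagonal √E).mulVec
        (v.vectorB (k E)) j * Complex.exp (-(Complex.I * (inner ℝ (l E) (v.y j) : ℝ)))) := by
      rw [hff, ← Finset.mul_sum]; field_simp; ring
    rw [v31, v321, fourierOfMeasure_discreteMeasure, fourierOfMeasure_discreteMeasure,
      finrank_euclideanSpace_fin, hff']
    congr 1
    rw [← mul_add, ← Finset.sum_add_distrib, mul_div_assoc ((2 * (Real.pi : ℂ)) ^ 3)⁻¹,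
      mul_div_assoc ((2 * (Real.pi : ℂ)) ^ 3)⁻¹, ← mul_add,
      Finset.sum_div, Finset.sum_div, ← Finset.sum_add_distrib]
    congr 1
    refine Finset.sum_congr rfl fun j _ => ?_
    have h := v.vectorB_mul_exp (hkl E) j
    have hI : Complex.I ≠ 0 := Complex.I_ne_zero
    have hx1 : (-(Complex.I * (√E : ℂ) / (4 * Real.pi)))⁻¹ = 4 * Real.pi * Complex.I / √E := by
      rw [inv_eq_iff_eq_inv, inv_div, neg_eq_iff_eq_neg, div_eq_iff (by simp [hpi])]
      field_simp
      linear_combination Complex.I_sq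
    have hx2 : ((-(Complex.I * (√E : ℂ) / (4 * Real.pi))) ^ 2)⁻¹
        = -(16 * (Real.pi : ℂ) ^ 2) / (√E : ℂ) ^ 2 := by
      rw [← inv_pow, hx1, div_pow, mul_pow, mul_pow, Complex.I_sq]
      ring
    rw [hx1, hx2]
    field_simp
    linear_combination
      (4 * Complex.I * (√E : ℂ) + 16 * Real.pi * v.α j) * h
  · filter_upwards [hk] with E hE
    rw [hE]

end Three

end MultipointPotential

/-! ### Fourier transforms of functions that are `O((1 + |x|)⁻¹)` -/

section FourierLp

open FourierTransform

theorem integral_fourier_mul_Lp_two (f : Lp ℂ 2 (volume : Measure ℝ)) (φ : 𝓢(ℝ, ℂ)) :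
    ∫ x, 𝓕 (φ : ℝ → ℂ) x * f x = ∫ x, φ x * (𝓕 f : Lp ℂ 2 (volume : Measure ℝ)) x := by
  have h := DFunLike.congr_fun (Lp.fourier_toTemperedDistribution_eq f) φ
  rw [TemperedDistribution.fourier_apply, Lp.toTemperedDistribution_apply,
    Lp.toTemperedDistribution_apply] at h
  simpa [SchwartzMap.fourier_coe] using h

/-- The `L²` transform and the `L¹` integral satisfy the same multiplication formula against test
functions, which determines a locally integrable function almost everywhere. -/
theorem fourier_toLp_two_ae_eq {g : ℝ → ℂ} (h1 : Integrable g) (h2 : MemLp g 2) :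
    (𝓕 (h2.toLp g) : Lp ℂ 2 (volume : Measure ℝ)) =ᵐ[volume] 𝓕 g := by
  have hcont : Continuous (𝓕 g) :=
    VectorFourier.fourierIntegral_continuous Real.continuous_fourierChar
      (by exact continuous_inner) h1
  refine ae_eq_of_integral_contDiff_smul_eq
    ((Lp.memLp _).locallyIntegrable (by norm_num)) hcont.locallyIntegrable ?_
  intro φ hφ hφc
  have hc1 : HasCompactSupport (Complex.ofRealCLM ∘ φ) := hφc.comp_left rfl
  have hc2 : ContDiff ℝ (⊤ : ℕ∞) (Complex.ofRealCLM ∘ φ) := by fun_prop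
  set ψ : 𝓢(ℝ, ℂ) := hc1.toSchwartzMap hc2 with hψ
  have hψφ : ∀ x, ψ x = (φ x : ℂ) := fun x => by simp [hψ]
  have h3 := integral_fourier_mul_Lp_two (h2.toLp g) ψ
  have h4 : ∫ x, 𝓕 (ψ : ℝ → ℂ) x * (h2.toLp g) x = ∫ x, 𝓕 (ψ : ℝ → ℂ) x * g x := by
    refine integral_congr_ae ?_
    filter_upwards [h2.coeFn_toLp] with x hx
    rw [hx]
  have h5 : ∫ x, 𝓕 (ψ : ℝ → ℂ) x * g x = ∫ x, ψ x * 𝓕 g x := by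
    simpa using! VectorFourier.integral_fourierIntegral_smul_eq_flip (L := innerₗ ℝ)
      Real.continuous_fourierChar (by exact continuous_inner) (ψ.integrable (μ := volume)) h1
  simp_rw [Complex.real_smul, ← hψφ]
  rw [← h3, h4, h5]

/-- Interpolation between `L²` and `L^∞`: `|f|^s ≤ B^(s-2) |f|²`. -/
theorem eLpNorm_le_of_ae_enorm_le {f : ℝ → ℂ} {B s : ℝ≥0∞} (hs : 2 ≤ s) (hs' : s < ∞)
    (hB : B ≠ ∞) (hf : ∀ᵐ x, ‖f x‖ₑ ≤ B) :
    eLpNorm f s ≤ (B ^ (s.toReal - 2) * eLpNorm f 2 ^ (2 : ℝ)) ^ (1 / s.toReal) := by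
  have hr : 2 ≤ s.toReal := by
    rw [← ENNReal.toReal_ofNat 2]
    exact ENNReal.toReal_mono hs'.ne hs
  have h0 : s ≠ 0 := (zero_lt_two.trans_le hs).ne'
  rw [eLpNorm_eq_lintegral_rpow_enorm_toReal h0 hs'.ne,
    eLpNorm_eq_lintegral_rpow_enorm_toReal two_ne_zero ENNReal.ofNat_ne_top]
  refine ENNReal.rpow_le_rpow ?_ (by positivity)
  rw [ENNReal.toReal_ofNat, ← ENNReal.rpow_mul, one_div_mul_cancel two_ne_zero, ENNReal.rpow_one]
  refine le_trans (lintegral_mono_ae ?_) (lintegral_const_mul' _ _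
    (ENNReal.rpow_ne_top_of_nonneg (by linarith) hB)).le
  filter_upwards [hf] with x hx
  calc ‖f x‖ₑ ^ s.toReal = ‖f x‖ₑ ^ (s.toReal - 2) * ‖f x‖ₑ ^ (2 : ℝ) := by
        rw [← ENNReal.rpow_add_of_nonneg _ _ (by linarith) (by norm_num), sub_add_cancel]
    _ ≤ _ := by gcongr

theorem eLpNorm_indicator_le_of_norm_le {H : ℝ → ℂ} {S : Set ℝ} (hS : MeasurableSet S) {c : ℝ}
    (hc : ∀ x ∈ S, ‖H x‖ ≤ c) (p : ℝ≥0∞) :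
    eLpNorm (S.indicator H) p ≤ volume S ^ p.toReal⁻¹ * ENNReal.ofReal c := by
  rw [eLpNorm_indicator_eq_eLpNorm_restrict hS]
  have := eLpNorm_le_of_ae_bound (μ := volume.restrict S) (p := p) (f := H) (C := c)
    (by filter_upwards [ae_restrict_mem hS] with x hx using hc x hx)
  simpa using this

/-- For a function of size `c` on a set of measure `M`, the transform is bounded by the `L¹` norm `M
c` and, by Plancherel, has squared `L²` norm at most `M c²`; then interpolate. -/
theorem eLpNorm_fourier_indicator_le {H : ℝ → ℂ} (hH : MemLp H 2) {S : Set ℝ}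
    (hS : MeasurableSet S) {M : ℝ} (hM0 : 0 ≤ M) (hM : volume S ≤ ENNReal.ofReal M) {c : ℝ}
    (hc0 : 0 ≤ c) (hc : ∀ x ∈ S, ‖H x‖ ≤ c) {s : ℝ≥0∞} (hs : 2 ≤ s) (hs' : s < ∞) :
    eLpNorm (𝓕 ((hH.indicator hS).toLp (S.indicator H)) : Lp ℂ 2 (volume : Measure ℝ)) s volume
      ≤ (ENNReal.ofReal (M * c) ^ (s.toReal - 2) * ENNReal.ofReal (M * c ^ 2))
        ^ (1 / s.toReal) := by
  have hr : 2 ≤ s.toReal := by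
    rw [← ENNReal.toReal_ofNat 2]
    exact ENNReal.toReal_mono hs'.ne hs
  have h1 : eLpNorm (S.indicator H) 1 ≤ ENNReal.ofReal (M * c) := by
    refine (eLpNorm_indicator_le_of_norm_le hS hc 1).trans ?_
    rw [ENNReal.toReal_one, inv_one, ENNReal.rpow_one, ENNReal.ofReal_mul hM0]
    gcongr
  have hint : Integrable (S.indicator H) :=
    memLp_one_iff_integrable.1 ⟨hH.1.indicator hS, h1.trans_lt ENNReal.ofReal_lt_top⟩
  have hB : ∀ᵐ x, ‖(𝓕 ((hH.indicator hS).toLp (S.indicator H)) : Lp ℂ 2 (volume : Measure ℝ)) x‖ₑ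
      ≤ ENNReal.ofReal (M * c) := by
    filter_upwards [fourier_toLp_two_ae_eq hint (hH.indicator hS)] with x hx
    rw [hx]
    refine le_trans ?_ h1
    rw [eLpNorm_one_eq_lintegral_enorm, Real.fourier_eq']
    refine (enorm_integral_le_lintegral_enorm _).trans (le_of_eq ?_)
    refine lintegral_congr fun y => ?_
    rw [enorm_smul, ← ofReal_norm,
      Complex.norm_exp_ofReal_mul_I, ENNReal.ofReal_one, one_mul]
  refine (eLpNorm_le_of_ae_enorm_le hs hs' ENNReal.ofReal_ne_top hB).trans ?_
  have h2 : eLpNorm (𝓕 ((hH.indicator hS).toLp (S.indicator H)) : Lp ℂ 2 (volume : Measure ℝ)) 2 volume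
      ^ (2 : ℝ) ≤ ENNReal.ofReal (M * c ^ 2) := by
    have h3 : eLpNorm (𝓕 ((hH.indicator hS).toLp (S.indicator H)) : Lp ℂ 2 (volume : Measure ℝ)) 2 volume
        = eLpNorm (S.indicator H) 2 := by
      rw [← Lp.enorm_def, ← eLpNorm_congr_ae (hH.indicator hS).coeFn_toLp, ← Lp.enorm_def,
        ← ofReal_norm, Lp.norm_fourier_eq, ofReal_norm]
    rw [h3]
    calc _ ≤ (volume S ^ (2 : ℝ≥0∞).toReal⁻¹ * ENNReal.ofReal c) ^ (2 : ℝ) := by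
          gcongr
          exact eLpNorm_indicator_le_of_norm_le hS hc 2
      _ = volume S * ENNReal.ofReal (c ^ 2) := by
          rw [ENNReal.mul_rpow_of_nonneg _ _ (by norm_num), ← ENNReal.rpow_mul,
            ENNReal.toReal_ofNat, inv_mul_cancel₀ (by norm_num), ENNReal.rpow_one,
            ENNReal.rpow_ofNat, ENNReal.ofReal_pow hc0]
      _ ≤ _ := by
          rw [ENNReal.ofReal_mul hM0]
          gcongr
  gcongr

theorem measurableSet_abs_lt (R : ℝ) : MeasurableSet {x : ℝ | |x| < R} :=
  measurableSet_lt (by fun_prop) measurable_const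

theorem volume_abs_lt (R : ℝ) : volume {x : ℝ | |x| < R} = ENNReal.ofReal (2 * R) := by
  have : {x : ℝ | |x| < R} = Set.Ioo (-R) R := by
    ext x; simp [abs_lt]
  rw [this, Real.volume_Ioo]
  congr 1; ring

theorem tendsto_toLp_indicator_abs_lt {H : ℝ → ℂ} (hH : MemLp H 2) :
    Tendsto (fun N : ℕ => ((hH.indicator (measurableSet_abs_lt (2 ^ N))).toLp
      ({x : ℝ | |x| < 2 ^ N}.indicator H) : Lp ℂ 2 (volume : Measure ℝ))) atTop (𝓝 (hH.toLp H)) := by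
  rw [Lp.tendsto_Lp_iff_tendsto_eLpNorm'']
  have hlim : Tendsto (fun N : ℕ =>
      ∫⁻ x, ‖({x : ℝ | |x| < 2 ^ N}.indicator H - H) x‖ₑ ^ (2 : ℝ)) atTop (𝓝 0) := by
    have := tendsto_lintegral_of_dominated_convergence' (μ := volume)
      (F := fun (N : ℕ) x => ‖({x : ℝ | |x| < 2 ^ N}.indicator H - H) x‖ₑ ^ (2 : ℝ))
      (f := fun _ => 0) (fun x => ‖H x‖ₑ ^ (2 : ℝ))
      (fun N => (((hH.1.indicator (measurableSet_abs_lt _)).sub hH.1).enorm).pow_const _)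
      (fun N => .of_forall fun x => by
        refine ENNReal.rpow_le_rpow ?_ (by norm_num)
        by_cases hx : x ∈ {x : ℝ | |x| < 2 ^ N}
        · simp only [Pi.sub_apply, Set.indicator_of_mem hx, sub_self, enorm_zero, zero_le]
        · simp only [Pi.sub_apply, Set.indicator_of_notMem hx, zero_sub, enorm_neg, le_refl])
      (by
        have := hH.2
        rw [eLpNorm_lt_top_iff_lintegral_rpow_enorm_lt_top two_ne_zero ENNReal.ofNat_ne_top] at this
        simpa using this.ne)
      (.of_forall fun x => by
        refine tendsto_const_nhds.congr' ?_
        filter_upwards [(tendsto_pow_atTop_atTop_of_one_lt (one_lt_two (α := ℝ))).eventually_gt_atTop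
          |x|] with N hN
        have hx : x ∈ {x : ℝ | |x| < 2 ^ N} := hN
        simp only [Pi.sub_apply, Set.indicator_of_mem hx, sub_self, enorm_zero]
        rw [ENNReal.zero_rpow_of_pos (by norm_num)])
    simpa using this
  have h2 := hlim.ennrpow_const (1 / 2 : ℝ)
  rw [ENNReal.zero_rpow_of_pos (by norm_num)] at h2
  refine h2.congr fun N => ?_
  rw [eLpNorm_eq_lintegral_rpow_enorm_toReal two_ne_zero ENNReal.ofNat_ne_top]
  simp

theorem memLp_two_of_norm_le_inv_one_add {H : ℝ → ℂ} (hH : AEStronglyMeasurable H) {C : ℝ}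
    (hC : ∀ x, ‖H x‖ ≤ C / (1 + |x|)) : MemLp H 2 := by
  rw [memLp_two_iff_integrable_sq_norm hH]
  have h := (integrable_one_add_norm (E := ℝ) (μ := volume) (r := 2) (by simp)).const_mul (C ^ 2)
  refine h.mono' (hH.norm.pow 2) (.of_forall fun x => ?_)
  rw [norm_pow, norm_norm, Real.rpow_neg (by positivity), Real.rpow_ofNat, ← div_eq_mul_inv,
    ← div_pow]
  gcongr
  exact hC x

/-- The Fourier transform of a function which is `O((1 + |x|)⁻¹)` lies in all `L^s`,
`2 ≤ s < ∞`. -/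
theorem memLp_fourier_of_norm_le_inv_one_add {H : ℝ → ℂ} (hH : MemLp H 2) {C : ℝ}
    (hC : ∀ x, ‖H x‖ ≤ C / (1 + |x|)) {s : ℝ≥0∞} (hs : 2 ≤ s) (hs' : s < ∞) :
    MemLp (𝓕 (hH.toLp H) : Lp ℂ 2 (volume : Measure ℝ)) s volume := by
  have hC0 : 0 ≤ C := by
    have := (norm_nonneg _).trans (hC 0)
    simpa using this
  have hr : 0 < s.toReal := ENNReal.toReal_pos (zero_lt_two.trans_le hs).ne' hs'.ne
  have hs1 : 1 ≤ s := le_trans (by norm_num) hs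
  set T : ℕ → Lp ℂ 2 (volume : Measure ℝ) := fun N => 𝓕 ((hH.indicator (measurableSet_abs_lt (2 ^ N))).toLp
    ({x : ℝ | |x| < 2 ^ N}.indicator H)) with hT
  -- The ring `2^N ≤ |x| < 2^(N+1)` has `M = 4 · 2^N` and `c = C / 2^N`, so `M c = 4 C` while `M c²
  -- = 4 C² 2^(-N)`. Its `L^s` contribution is therefore `K ρ^N` with `ρ = 2^(-1/s) < 1`, a summable
  -- series.
  set ρ : ℝ≥0∞ := (ENNReal.ofReal 2⁻¹) ^ (1 / s.toReal) with hρ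
  set K : ℝ≥0∞ := (ENNReal.ofReal (4 * C) ^ (s.toReal - 2) * ENNReal.ofReal (4 * C ^ 2))
    ^ (1 / s.toReal) with hK
  have hr2 : 2 ≤ s.toReal := by
    rw [← ENNReal.toReal_ofNat 2]
    exact ENNReal.toReal_mono hs'.ne hs
  have hKtop : K ≠ ∞ := by
    refine ENNReal.rpow_ne_top_of_nonneg (by positivity) (ENNReal.mul_ne_top ?_ ?_)
    · exact ENNReal.rpow_ne_top_of_nonneg (by linarith) ENNReal.ofReal_ne_top
    · exact ENNReal.ofReal_ne_top
  have hρ1 : ρ < 1 := ENNReal.rpow_lt_one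
    (by rw [← ENNReal.ofReal_one, ENNReal.ofReal_lt_ofReal_iff one_pos]; norm_num) (by positivity)
  have h0 : eLpNorm (T 0) s ≤ K := by
    refine (eLpNorm_fourier_indicator_le hH (measurableSet_abs_lt _) (M := 4) (by norm_num) ?_
      hC0 ?_ hs hs')
    · rw [volume_abs_lt]
      exact ENNReal.ofReal_le_ofReal (by norm_num)
    · intro x _
      exact (hC x).trans (div_le_self hC0 (by linarith [abs_nonneg x]))
  have hstep : ∀ N, eLpNorm (T (N + 1)) s ≤ eLpNorm (T N) s + K * ρ ^ N := by
    intro N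
    have hAm : MeasurableSet ({x : ℝ | |x| < 2 ^ (N + 1)} \ {x : ℝ | |x| < 2 ^ N}) :=
      (measurableSet_abs_lt _).diff (measurableSet_abs_lt _)
    have hdec : T (N + 1) = T N + 𝓕 ((hH.indicator hAm).toLp _) := by
      rw [hT]
      simp only
      rw [← FourierAdd.fourier_add, ← MemLp.toLp_add]
      congr 1
      refine MemLp.toLp_congr _ _ (.of_forall fun x => ?_)
      have hsub : {x : ℝ | |x| < 2 ^ N} ⊆ {x : ℝ | |x| < 2 ^ (N + 1)} := 
        fun x (hx : |x| < 2 ^ N) => show |x| < 2 ^ (N + 1) from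
          hx.trans_le (pow_le_pow_right₀ one_le_two N.le_succ)
      rw [Set.indicator_sdiff hsub]
      simp
    rw [hdec, eLpNorm_congr_ae (Lp.coeFn_add _ _)]
    refine (eLpNorm_add_le (Lp.aestronglyMeasurable _) (Lp.aestronglyMeasurable _) hs1).trans ?_
    gcongr
    have h2N : (0 : ℝ) < 2 ^ N := by positivity
    refine (eLpNorm_fourier_indicator_le hH hAm (M := 4 * 2 ^ N) (by positivity) ?_
      (c := C / 2 ^ N) (by positivity) ?_ hs hs').trans (le_of_eq ?_)
    · refine (measure_mono Set.sdiff_subset).trans ?_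
      rw [volume_abs_lt]
      exact ENNReal.ofReal_le_ofReal (by rw [pow_succ]; linarith)
    · intro x hx
      have : (2 : ℝ) ^ N ≤ |x| := not_lt.1 hx.2
      refine (hC x).trans ?_
      gcongr
      linarith
    · have e1 : 4 * 2 ^ N * (C / 2 ^ N) = 4 * C := by field_simp
      have e2 : 4 * 2 ^ N * (C / 2 ^ N) ^ 2 = 4 * C ^ 2 * 2⁻¹ ^ N := by
        rw [inv_pow]; field_simp
      rw [e1, e2, ENNReal.ofReal_mul (by positivity : 0 ≤ 4 * C ^ 2), ← mul_assoc,
        ENNReal.mul_rpow_of_nonneg _ _ (by positivity), ENNReal.ofReal_pow (by norm_num),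
        ← ENNReal.rpow_natCast, ← ENNReal.rpow_natCast, hρ, ← ENNReal.rpow_mul,
        ← ENNReal.rpow_mul, mul_comm (1 / s.toReal)]
  have hbound : ∀ N, eLpNorm (T N) s ≤ K + K * (1 - ρ)⁻¹ := by
    have h1 : ∀ N, eLpNorm (T N) s ≤ K + K * ∑ n ∈ Finset.range N, ρ ^ n := by
      intro N
      induction N with
      | zero => simpa using h0
      | succ N ih =>
        refine (hstep N).trans ?_
        rw [Finset.sum_range_succ, mul_add, ← add_assoc]
        gcongr
    intro N
    refine (h1 N).trans ?_
    gcongr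
    rw [← ENNReal.tsum_geometric]
    exact ENNReal.sum_le_tsum _
  have hlim : Tendsto T atTop (𝓝 (𝓕 (hH.toLp H))) :=
    (FourierTransform.continuous_fourier.tendsto _).comp
      (tendsto_toLp_indicator_abs_lt hH)
  -- Convergence is known in `L²` only; an almost everywhere convergent subsequence carries the
  -- uniform `L^s` bound to the limit by Fatou.
  obtain ⟨ns, -, hns⟩ := (tendstoInMeasure_of_tendsto_Lp hlim).exists_seq_tendsto_ae
  refine ⟨Lp.aestronglyMeasurable _, lt_of_le_of_lt (Lp.eLpNorm_le_of_ae_tendsto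
    (f := fun i => (T (ns i) : ℝ → ℂ)) (u := atTop) (.of_forall fun n => hbound (ns n))
    (fun n => Lp.aestronglyMeasurable _) hns) ?_⟩
  refine ENNReal.add_lt_top.2 ⟨hKtop.lt_top, ENNReal.mul_lt_top hKtop.lt_top ?_⟩
  exact ENNReal.inv_lt_top.2 (tsub_pos_of_lt hρ1)

end FourierLp

/-! ### Backscattering in dimension one -/

namespace MultipointPotential

theorem greenPlus_one (x κ : ℝ) :
    greenPlus x κ = Complex.exp (Complex.I * κ * ‖x‖) / (2 * Complex.I * κ) := by
  rw [greenPlus, Module.finrank_self]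
  rfl

theorem diagonalEntry_one (α : ℂ) (κ : ℝ) :
    diagonalEntry 1 α κ = α + (2 * Complex.I * κ)⁻¹ := rfl

variable (v : MultipointPotential ℝ)

/-- In dimension one, `A(κ) = diag(α) + κ⁻¹ phaseMatrix κ`. -/
def phaseMatrix (κ : ℝ) : Matrix (Fin v.n) (Fin v.n) ℂ :=
  Matrix.of fun i j => Complex.exp (Complex.I * κ * ‖v.y i - v.y j‖) / (2 * Complex.I)

theorem matrixA_one_eq (κ : ℝ) :
    v.matrixA κ = Matrix.diagonal v.α + (κ : ℂ)⁻¹ • v.phaseMatrix κ := by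
  ext i j
  by_cases h : i = j
  · subst h
    simp only [matrixA, Matrix.of_apply, if_true, Module.finrank_self, diagonalEntry_one,
      Matrix.add_apply, Matrix.diagonal_apply_eq, Matrix.smul_apply, phaseMatrix, sub_self,
      norm_zero, Complex.ofReal_zero, mul_zero, Complex.exp_zero, smul_eq_mul]
    rw [mul_inv, mul_comm, one_div]
  · simp only [matrixA, Matrix.of_apply, if_neg h, greenPlus_one,
      Matrix.add_apply, Matrix.diagonal_apply_ne _ h, Matrix.smul_apply, phaseMatrix, smul_eq_mul]
    rw [zero_add, div_mul_eq_div_div, div_eq_mul_inv _ (κ : ℂ), mul_comm]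

theorem norm_phaseMatrix_apply_le (κ : ℝ) (i j : Fin v.n) : ‖v.phaseMatrix κ i j‖ ≤ 1 := by
  rw [phaseMatrix, Matrix.of_apply, norm_div, mul_assoc, mul_comm Complex.I, ← Complex.ofReal_mul,
    Complex.norm_exp_ofReal_mul_I]
  norm_num

/-- The sum of the inverse strengths, in absolute value. -/
def inverseStrength : ℝ := ∑ j, ‖(v.α j)⁻¹‖

theorem norm_inv_le_inverseStrength (j : Fin v.n) : ‖(v.α j)⁻¹‖ ≤ v.inverseStrength :=
  Finset.single_le_sum (f := fun j => ‖(v.α j)⁻¹‖) (fun _ _ => norm_nonneg _) (Finset.mem_univ j)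

theorem inverseStrength_nonneg : 0 ≤ v.inverseStrength :=
  Finset.sum_nonneg fun _ _ => norm_nonneg _

theorem norm_scaled_phaseMatrix_le (κ : ℝ) (i j : Fin v.n) :
    ‖(Matrix.diagonal (fun j => (v.α j)⁻¹) * v.phaseMatrix κ) i j‖ ≤ v.inverseStrength := by
  rw [Matrix.diagonal_mul, norm_mul]
  exact (mul_le_of_le_one_right (norm_nonneg _) (v.norm_phaseMatrix_apply_le κ i j)).trans
    (v.norm_inv_le_inverseStrength i)

/-- As `A(κ)` has no growing part here, it is rescaled so that the perturbation lemmas apply with `x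
= κ`. -/
theorem scaled_matrixA_eq (hα : ∀ j, v.α j ≠ 0) {κ : ℝ} (hκ : κ ≠ 0) :
    Matrix.diagonal (fun j => (κ : ℂ) * (v.α j)⁻¹) * v.matrixA κ
      = (κ : ℂ) • (1 : Matrix (Fin v.n) (Fin v.n) ℂ)
        + Matrix.diagonal (fun j => (v.α j)⁻¹) * v.phaseMatrix κ := by
  have hκ' : (κ : ℂ) ≠ 0 := by exact_mod_cast hκ
  rw [matrixA_one_eq, mul_add, Matrix.diagonal_mul_diagonal]
  congr 1
  · rw [Matrix.smul_one_eq_diagonal]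
    congr 1
    funext j
    rw [mul_assoc, inv_mul_cancel₀ (hα j), mul_one]
  · ext i j
    rw [Matrix.diagonal_mul, Matrix.diagonal_mul, Matrix.smul_apply, smul_eq_mul]
    field_simp

theorem solvableAt_one (hα : ∀ j, v.α j ≠ 0) {κ : ℝ} (hκ : 0 < κ)
    (hκ' : 2 * (v.n * v.inverseStrength) ≤ κ) : v.SolvableAt κ := by
  have hn : ‖(κ : ℂ)‖ = κ := by rw [Complex.norm_real, Real.norm_of_nonneg hκ.le]
  have h := isUnit_det_smul_one_add v.inverseStrength_nonneg (v.norm_scaled_phaseMatrix_le κ)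
    (x := κ) (by rwa [hn]) (by rwa [hn])
  rw [← v.scaled_matrixA_eq hα hκ.ne', Matrix.det_mul] at h
  exact isUnit_of_mul_isUnit_right h

/-- After rescaling, the right-hand side has size `κ`, so the `κ⁻²` of the first-order remainder
becomes `κ⁻¹`. -/
theorem norm_chargeQ_sub_le (hα : ∀ j, v.α j ≠ 0) {k : ℝ} (hk : 0 < |k|)
    (hk' : 2 * (v.n * v.inverseStrength) ≤ |k|) (j : Fin v.n) :
    ‖v.chargeQ k j - (v.α j)⁻¹ * v.vectorB k j‖
      ≤ 2 * (v.n * v.inverseStrength) * v.inverseStrength / |k| := by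
  have hn : ‖((|k| : ℝ) : ℂ)‖ = |k| := by rw [Complex.norm_real, Real.norm_of_nonneg hk.le]
  have hk0 : ((|k| : ℝ) : ℂ) ≠ 0 := by exact_mod_cast hk.ne'
  have hs : v.SolvableAt ‖k‖ := v.solvableAt_one hα hk hk'
  have hq := congrArg (Matrix.diagonal fun j => ((|k| : ℝ) : ℂ) * (v.α j)⁻¹).mulVec
    (v.matrixA_mulVec_chargeQ hs)
  rw [Matrix.mulVec_mulVec, Real.norm_eq_abs, v.scaled_matrixA_eq hα hk.ne', Matrix.add_mulVec,
    Matrix.smul_mulVec, Matrix.one_mulVec] at hq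
  have hI := v.inverseStrength_nonneg
  have hb := norm_sub_inv_smul_le_of_smul_add_eq
    (T := (Matrix.diagonal (fun j => (v.α j)⁻¹) * v.phaseMatrix |k|).mulVecLin)
    (C := v.n * v.inverseStrength) (by positivity)
    (norm_mulVec_le hI (v.norm_scaled_phaseMatrix_le |k|)) (by rwa [hn]) (by rwa [hn]) hq
  have hrhs : ‖(Matrix.diagonal fun j => ((|k| : ℝ) : ℂ) * (v.α j)⁻¹).mulVec (v.vectorB k)‖
      ≤ |k| * v.inverseStrength := by
    rw [pi_norm_le_iff_of_nonneg (by positivity)]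
    intro i
    rw [Matrix.mulVec_diagonal, norm_mul, v.norm_vectorB_apply, mul_one, norm_mul, hn]
    gcongr
    exact v.norm_inv_le_inverseStrength i
  have hj := (norm_le_pi_norm _ j).trans hb
  rw [Pi.sub_apply, Pi.smul_apply, Matrix.mulVec_diagonal, smul_eq_mul, mul_assoc,
    inv_mul_cancel_left₀ hk0] at hj
  refine hj.trans ?_
  rw [hn]
  calc _ ≤ 2 * (v.n * v.inverseStrength) * (|k| * v.inverseStrength) / |k| ^ 2 := by gcongr
    _ = _ := by field_simp

/-- The backscattering amplitude `p ↦ f(p/2, -p/2)` on the line. -/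
def backscattering (p : ℝ) : ℂ := v.amplitude (p / 2) (-p / 2)

theorem fourierOfMeasure_v11 (p : ℝ) : fourierOfMeasure v.v11 p = (2 * Real.pi : ℂ)⁻¹ *
    ∑ j, Complex.exp (Complex.I * (p * v.y j : ℝ)) * (-1 / v.α j) := by
  rw [v11, fourierOfMeasure_discreteMeasure, Module.finrank_self, pow_one]
  simp [mul_comm]

theorem norm_backscattering_sub_le (hα : ∀ j, v.α j ≠ 0) {p : ℝ} (hp : 0 < |p|)
    (hp' : 4 * (v.n * v.inverseStrength) ≤ |p|) :
    ‖v.backscattering p - fourierOfMeasure v.v11 p‖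
      ≤ ‖(2 * Real.pi : ℂ)⁻¹‖ * (v.n * (4 * (v.n * v.inverseStrength) * v.inverseStrength)) / |p| := by
  have habs : |p / 2| = |p| / 2 := by rw [abs_div, abs_two]
  have hmain : fourierOfMeasure v.v11 p = (2 * Real.pi : ℂ)⁻¹ * ∑ j, (v.α j)⁻¹ *
      v.vectorB (p / 2) j * Complex.exp (-(Complex.I * (inner ℝ (-p / 2) (v.y j) : ℝ))) := by
    rw [fourierOfMeasure_v11]
    congr 1
    refine Finset.sum_congr rfl fun j _ => ?_
    rw [mul_assoc, v.vectorB_mul_exp (show p / 2 - -p / 2 = p by ring)]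
    rw [show (inner ℝ p (v.y j) : ℝ) = p * v.y j by simp [mul_comm]]
    ring
  rw [backscattering, amplitude, Module.finrank_self, pow_one, hmain, ← mul_sub, norm_mul,
    mul_div_assoc, ← Finset.sum_sub_distrib]
  gcongr
  refine (norm_sum_le _ _).trans ?_
  calc _ ≤ ∑ _j : Fin v.n, 4 * (v.n * v.inverseStrength) * v.inverseStrength / |p| := by
        refine Finset.sum_le_sum fun j _ => ?_
        rw [← sub_mul, norm_mul, mul_comm Complex.I, ← neg_mul, ← Complex.ofReal_neg,
          Complex.norm_exp_ofReal_mul_I, mul_one]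
        refine (v.norm_chargeQ_sub_le hα (by rw [habs]; positivity)
          (by rw [habs]; linarith) j).trans (le_of_eq ?_)
        rw [habs]
        field_simp
        ring
    _ = _ := by simp [mul_div_assoc]

/-- The inverse is the adjugate over a nonvanishing determinant. Continuity supplies measurability
and bounds at intermediate energies. -/
theorem continuousOn_backscattering {a : ℝ} (ha : 0 < a)
    (hs : ∀ κ, a ≤ κ → v.SolvableAt κ) :
    ContinuousOn v.backscattering {p : ℝ | 2 * a ≤ |p|} := by
  have hmem : ∀ p ∈ {p : ℝ | 2 * a ≤ |p|}, a ≤ ‖p / 2‖ := by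
    intro p (hp : 2 * a ≤ |p|)
    rw [Real.norm_eq_abs, abs_div, abs_two]
    linarith
  have hA : ContinuousOn (fun p : ℝ => v.matrixA ‖p / 2‖) {p : ℝ | 2 * a ≤ |p|} := by
    simp_rw [matrixA_one_eq]
    refine continuousOn_const.add (ContinuousOn.fun_smul ?_ ?_)
    · refine ContinuousOn.inv₀ (by fun_prop) fun p hp => ?_
      exact_mod_cast (ha.trans_le (hmem p hp)).ne'
    · refine Continuous.continuousOn (continuous_matrix fun i j => ?_)
      simp only [phaseMatrix, Matrix.of_apply]
      fun_prop
  have hinv : ContinuousOn (fun p : ℝ => (v.matrixA ‖p / 2‖)⁻¹) {p : ℝ | 2 * a ≤ |p|} := by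
    simp_rw [Matrix.inv_def, Ring.inverse_eq_inv']
    refine ContinuousOn.smul (ContinuousOn.inv₀ ?_ fun p hp => (hs _ (hmem p hp)).ne_zero) ?_
    · exact (continuous_id.matrix_det).comp_continuousOn hA
    · exact (continuous_id.matrix_adjugate).comp_continuousOn hA
  have hent : ∀ i j, ContinuousOn (fun p : ℝ => (v.matrixA ‖p / 2‖)⁻¹ i j)
      {p : ℝ | 2 * a ≤ |p|} := fun i j =>
    (continuous_id.matrix_elem i j).comp_continuousOn hinv
  change ContinuousOn (fun p => v.backscattering p) _
  simp only [backscattering, amplitude, chargeQ, Matrix.mulVec, dotProduct]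
  refine continuousOn_const.mul (continuousOn_finsetSum _ fun j _ => ContinuousOn.mul ?_ ?_)
  · refine continuousOn_finsetSum _ fun i _ => (hent j i).mul ?_
    simp only [vectorB]
    fun_prop
  · fun_prop

theorem continuous_fourierOfMeasure_v11 : Continuous fun p : ℝ => fourierOfMeasure v.v11 p := by
  simp_rw [fourierOfMeasure_v11]
  fun_prop

theorem norm_fourierOfMeasure_v11_le (p : ℝ) :
    ‖fourierOfMeasure v.v11 p‖ ≤ ‖(2 * Real.pi : ℂ)⁻¹‖ * v.inverseStrength := by
  rw [fourierOfMeasure_v11, norm_mul]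
  gcongr
  refine (norm_sum_le _ _).trans (Finset.sum_le_sum fun j _ => ?_)
  rw [norm_mul, mul_comm Complex.I, Complex.norm_exp_ofReal_mul_I, one_mul, neg_div, norm_neg,
    one_div]

/-- `ℱv` minus the backscattering amplitude cut off to `|p| > R`. -/
def fourierRemainder (R p : ℝ) : ℂ :=
  fourierOfMeasure v.v11 p - {p : ℝ | R < |p|}.indicator v.backscattering p

theorem measurableSet_lt_abs (R : ℝ) : MeasurableSet {p : ℝ | R < |p|} :=
  measurableSet_lt measurable_const (by fun_prop)

theorem aestronglyMeasurable_indicator_backscattering {a : ℝ} (ha : 0 < a)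
    (hs : ∀ κ, a ≤ κ → v.SolvableAt κ) :
    AEStronglyMeasurable ({p : ℝ | 2 * a < |p|}.indicator v.backscattering) := by
  rw [aestronglyMeasurable_indicator_iff (measurableSet_lt_abs _)]
  exact ((v.continuousOn_backscattering ha hs).mono fun p (hp : 2 * a < |p|) =>
    hp.le).aestronglyMeasurable (measurableSet_lt_abs _)

theorem exists_norm_fourierRemainder_le (hα : ∀ j, v.α j ≠ 0) {a : ℝ} (ha : 0 < a)
    (hs : ∀ κ, a ≤ κ → v.SolvableAt κ) :
    ∃ C, ∀ p, ‖v.fourierRemainder (2 * a) p‖ ≤ C / (1 + |p|) := by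
  set K := ‖(2 * Real.pi : ℂ)⁻¹‖ * (v.n * (4 * (v.n * v.inverseStrength) * v.inverseStrength))
  set R := max 1 (4 * (v.n * v.inverseStrength))
  set B := ‖(2 * Real.pi : ℂ)⁻¹‖ * v.inverseStrength
  have hI := v.inverseStrength_nonneg
  have hK : 0 ≤ K := by positivity
  have hB : 0 ≤ B := by positivity
  have hcomp : IsCompact ({p : ℝ | 2 * a ≤ |p|} ∩ Set.Icc (-R) R) :=
    isCompact_Icc.inter_left (isClosed_le continuous_const (by fun_prop))
  obtain ⟨D, hD⟩ := hcomp.exists_bound_of_continuousOn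
    (((v.continuousOn_backscattering ha hs).mono Set.inter_subset_left).sub
      v.continuous_fourierOfMeasure_v11.continuousOn)
  -- The three constants serve the cut-off region `|p| ≤ 2a`, the asymptotic region `|p| > R`, and
  -- the compact region between, where continuity gives `D`.
  refine ⟨max (B * (1 + 2 * a)) (max (2 * K) (D * (1 + R))), fun p => ?_⟩
  have hpos : 0 < 1 + |p| := by positivity
  rw [le_div_iff₀ hpos]
  by_cases hp : 2 * a < |p|
  · have hmem : p ∈ {p : ℝ | 2 * a < |p|} := hp
    rw [fourierRemainder, Set.indicator_of_mem hmem, norm_sub_rev]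
    by_cases hR : |p| ≤ R
    · have h := hD p ⟨hp.le, abs_le.1 hR⟩
      have hD0 : 0 ≤ D := (norm_nonneg _).trans h
      refine le_trans ?_ ((le_max_right _ _).trans (le_max_right _ _))
      gcongr
      exact h
    · have h1 : 1 ≤ |p| := (le_max_left _ _).trans (not_le.1 hR).le
      have h := v.norm_backscattering_sub_le hα (one_pos.trans_le h1)
        ((le_max_right _ _).trans (not_le.1 hR).le)
      refine le_trans ?_ ((le_max_left _ _).trans (le_max_right _ _))
      calc _ ≤ K / |p| * (1 + |p|) := by gcongr
        _ ≤ K / |p| * (2 * |p|) := by gcongr; linarith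
        _ = 2 * K := by field_simp
  · have hmem : p ∉ {p : ℝ | 2 * a < |p|} := hp
    rw [fourierRemainder, Set.indicator_of_notMem hmem, sub_zero]
    refine le_trans ?_ (le_max_left _ _)
    gcongr
    · exact v.norm_fourierOfMeasure_v11_le p
    · exact not_lt.1 hp

theorem exists_norm_backscattering_le (hα : ∀ j, v.α j ≠ 0) {a : ℝ} (ha : 0 < a)
    (hs : ∀ κ, a ≤ κ → v.SolvableAt κ) :
    ∃ C, ∀ p ∈ {p : ℝ | 2 * a < |p|}, ‖v.backscattering p‖ ≤ C := by
  obtain ⟨C, hC⟩ := v.exists_norm_fourierRemainder_le hα ha hs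
  refine ⟨‖(2 * Real.pi : ℂ)⁻¹‖ * v.inverseStrength + C, fun p hp => ?_⟩
  have hC0 : 0 ≤ C := by simpa using (norm_nonneg _).trans (hC 0)
  have h : v.backscattering p = fourierOfMeasure v.v11 p - v.fourierRemainder (2 * a) p := by
    rw [fourierRemainder, Set.indicator_of_mem hp, sub_sub_cancel]
  rw [h]
  refine (norm_sub_le _ _).trans (add_le_add (v.norm_fourierOfMeasure_v11_le p)
    ((hC p).trans (div_le_self hC0 ?_)))
  linarith [abs_nonneg p]

end MultipointPotential

/-! ### The difference as a tempered distribution -/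

section Distribution

open FourierTransform

theorem integral_exp_mul_eq_fourier (φ : 𝓢(ℝ, ℂ)) (p : ℝ) :
    ∫ x : ℝ, Complex.exp (-(Complex.I * p * x)) * φ x = 𝓕 (φ : ℝ → ℂ) (p / (2 * Real.pi)) := by
  rw [Real.fourier_eq']
  refine integral_congr_ae (.of_forall fun x => ?_)
  simp only [smul_eq_mul, RCLike.inner_apply, conj_trivial]
  congr 2
  have : (Real.pi : ℂ) ≠ 0 := by exact_mod_cast Real.pi_ne_zero
  push_cast
  field_simp

theorem schwartz_apply_eq_integral (φ : 𝓢(ℝ, ℂ)) (y : ℝ) :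
    φ y = ∫ ξ : ℝ, Complex.exp (Complex.I * (2 * Real.pi * ξ * y : ℝ)) * 𝓕 (φ : ℝ → ℂ) ξ := by
  have h : 𝓕⁻ (𝓕 (φ : ℝ → ℂ)) = φ :=
    φ.continuous.fourierInv_fourier_eq φ.integrable (by
      rw [← SchwartzMap.fourier_coe]; exact (𝓕 φ).integrable)
  have h1 := congrFun h y
  rw [← h1, Real.fourierInv_eq']
  refine integral_congr_ae (.of_forall fun ξ => ?_)
  simp only [smul_eq_mul, RCLike.inner_apply, conj_trivial]
  congr 2
  push_cast
  ring

theorem integrable_fourier_schwartz (φ : 𝓢(ℝ, ℂ)) : Integrable (𝓕 (φ : ℝ → ℂ)) := by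
  rw [← SchwartzMap.fourier_coe]
  exact (𝓕 φ).integrable

theorem integral_v11_eq (v : MultipointPotential ℝ) (φ : 𝓢(ℝ, ℂ)) :
    ∫ᵛ x, φ x ∂[ContinuousLinearMap.mul ℝ ℂ; v.v11]
      = ∫ ξ : ℝ, 2 * Real.pi * fourierOfMeasure v.v11 (2 * Real.pi * ξ) * 𝓕 (φ : ℝ → ℂ) ξ := by
  have hpi : (Real.pi : ℂ) ≠ 0 := by exact_mod_cast Real.pi_ne_zero
  have h : ∀ ξ : ℝ, 2 * Real.pi * fourierOfMeasure v.v11 (2 * Real.pi * ξ) * 𝓕 (φ : ℝ → ℂ) ξ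
      = ∑ j, Complex.exp (Complex.I * (2 * Real.pi * ξ * v.y j : ℝ)) * 𝓕 (φ : ℝ → ℂ) ξ
        * (-1 / v.α j) := by
    intro ξ
    rw [v.fourierOfMeasure_v11, mul_inv_cancel_left₀ (by simp [hpi]), Finset.sum_mul]
    refine Finset.sum_congr rfl fun j _ => ?_
    ring
  simp_rw [h]
  rw [integral_finsetSum]
  · simp_rw [integral_mul_const, ← schwartz_apply_eq_integral]
    rw [MultipointPotential.v11, integral_discreteMeasure]
  · intro j _
    refine Integrable.mul_const ?_ _
    refine (integrable_fourier_schwartz φ).bdd_mul (c := 1) ?_ (.of_forall fun ξ => ?_)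
    · exact Continuous.aestronglyMeasurable (by fun_prop)
    · rw [mul_comm, Complex.norm_exp_ofReal_mul_I]

theorem integrable_bdd_mul_fourier {g : ℝ → ℂ} (hg : AEStronglyMeasurable g) {C : ℝ}
    (hC : ∀ p, ‖g p‖ ≤ C) (φ : 𝓢(ℝ, ℂ)) : Integrable fun p => g p * 𝓕 (φ : ℝ → ℂ) p :=
  (integrable_fourier_schwartz φ).bdd_mul (c := C) hg (.of_forall hC)

theorem differenceMemLs_backscattering (v : MultipointPotential ℝ) (hα : ∀ j, v.α j ≠ 0)
    {E₀ : ℝ} (hE : 0 < E₀) (hs : ∀ κ : ℝ, √E₀ ≤ κ → v.SolvableAt κ) {s : ℝ≥0∞} (h2 : 2 ≤ s)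
    (hs' : s < ∞) : DifferenceMemLs v.v11 v.backscattering E₀ s := by
  have ha : 0 < √E₀ := Real.sqrt_pos.2 hE
  set S : Set ℝ := {p : ℝ | 2 * √E₀ < |p|} with hS
  have hSm : MeasurableSet S := MultipointPotential.measurableSet_lt_abs _
  have hπ : (2 * Real.pi : ℝ) ≠ 0 := by positivity
  set F := S.indicator v.backscattering with hF
  have hFm : AEStronglyMeasurable F := v.aestronglyMeasurable_indicator_backscattering ha hs
  have hscale : Measure.QuasiMeasurePreserving (fun ξ : ℝ => 2 * Real.pi * ξ) volume volume :=
    ⟨by fun_prop, by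
      rw [Real.map_volume_mul_left hπ]
      exact Measure.smul_absolutelyContinuous⟩
  have hFm' : AEStronglyMeasurable fun ξ => F (2 * Real.pi * ξ) :=
    hFm.comp_quasiMeasurePreserving hscale
  obtain ⟨B, hB⟩ := v.exists_norm_backscattering_le hα ha hs
  have hFB : ∀ p, ‖F p‖ ≤ |B| := by
    intro p
    by_cases hp : p ∈ S
    · rw [hF, Set.indicator_of_mem hp]
      exact (hB p hp).trans (le_abs_self B)
    · rw [hF, Set.indicator_of_notMem hp, norm_zero]
      exact abs_nonneg B
  obtain ⟨C, hC⟩ := v.exists_norm_fourierRemainder_le hα ha hs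
  have hC0 : 0 ≤ C := by simpa using (norm_nonneg _).trans (hC 0)
  -- The substitution `p = 2πξ` passes to the Fourier normalization `exp (-2πi ξ x)`. The `L²`
  -- transform of `H` is the function representing the difference.
  set H : ℝ → ℂ := fun ξ => 2 * Real.pi * v.fourierRemainder (2 * √E₀) (2 * Real.pi * ξ) with hH
  have hHeq : ∀ ξ, H ξ = 2 * Real.pi * fourierOfMeasure v.v11 (2 * Real.pi * ξ)
      - 2 * Real.pi * F (2 * Real.pi * ξ) := fun ξ => mul_sub _ _ _
  have hHm : AEStronglyMeasurable H := by
    refine AEStronglyMeasurable.congr (AEStronglyMeasurable.sub ?_ (hFm'.const_mul _))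
      (.of_forall fun ξ => (hHeq ξ).symm)
    have := v.continuous_fourierOfMeasure_v11
    exact Continuous.aestronglyMeasurable (by fun_prop)
  have hHC : ∀ ξ, ‖H ξ‖ ≤ 2 * Real.pi * C / (1 + |ξ|) := by
    intro ξ
    have hn : ‖(2 * Real.pi : ℂ)‖ = 2 * Real.pi := by simp [abs_of_pos Real.pi_pos]
    rw [hH, norm_mul, hn, mul_div_assoc]
    have hle : |ξ| ≤ |2 * Real.pi * ξ| := by
      rw [abs_mul, abs_of_pos (by positivity : 0 < 2 * Real.pi)]
      exact le_mul_of_one_le_left (abs_nonneg _) (by linarith [Real.pi_gt_three])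
    exact mul_le_mul_of_nonneg_left ((hC _).trans
      (div_le_div_of_nonneg_left hC0 (by positivity) (by linarith))) (by positivity)
  have hH2 := memLp_two_of_norm_le_inv_one_add hHm hHC
  refine ⟨(𝓕 (hH2.toLp H) : Lp ℂ 2 (volume : Measure ℝ)),
    memLp_fourier_of_norm_le_inv_one_add hH2 hHC h2 hs', fun φ => ?_⟩
  simp_rw [integral_exp_mul_eq_fourier]
  have hcut : ∀ p, S.indicator (fun p => v.backscattering p * 𝓕 (φ : ℝ → ℂ) (p / (2 * Real.pi))) p
      = F p * 𝓕 (φ : ℝ → ℂ) (p / (2 * Real.pi)) := by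
    intro p
    by_cases hp : p ∈ S
    · rw [hF, Set.indicator_of_mem hp, Set.indicator_of_mem hp]
    · rw [hF, Set.indicator_of_notMem hp, Set.indicator_of_notMem hp, zero_mul]
  constructor
  · rw [← integrable_indicator_iff hSm, funext hcut]
    exact ((integrable_fourier_schwartz φ).comp_div hπ).bdd_mul (c := |B|) hFm (.of_forall hFB)
  · rw [← integral_indicator hSm, funext hcut, integral_v11_eq]
    have hsub : ∫ p, F p * 𝓕 (φ : ℝ → ℂ) (p / (2 * Real.pi))
        = ∫ ξ, 2 * Real.pi * F (2 * Real.pi * ξ) * 𝓕 (φ : ℝ → ℂ) ξ := by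
      have h := Measure.integral_comp_mul_left
        (fun p => F p * 𝓕 (φ : ℝ → ℂ) (p / (2 * Real.pi))) (2 * Real.pi)
      rw [abs_of_pos (by positivity), Complex.real_smul, eq_comm, Complex.ofReal_inv,
        inv_mul_eq_iff_eq_mul₀ (by exact_mod_cast hπ)] at h
      rw [h, ← integral_const_mul]
      refine integral_congr_ae (.of_forall fun ξ => ?_)
      simp only
      rw [mul_div_cancel_left₀ _ hπ]
      push_cast
      ring
    rw [hsub, ← integral_sub]
    · have hpair := integral_fourier_mul_Lp_two (hH2.toLp H) φ
      simp_rw [mul_comm _ (φ _)]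
      rw [← hpair]
      refine integral_congr_ae ?_
      filter_upwards [hH2.coeFn_toLp] with ξ hξ
      rw [hξ, hHeq]
      ring
    · refine integrable_bdd_mul_fourier (C := ‖(2 * Real.pi : ℂ)‖ *
        (‖(2 * Real.pi : ℂ)⁻¹‖ * v.inverseStrength)) ?_ (fun ξ => ?_) φ
      · have := v.continuous_fourierOfMeasure_v11
        exact Continuous.aestronglyMeasurable (by fun_prop)
      · rw [norm_mul]
        gcongr
        exact v.norm_fourierOfMeasure_v11_le _
    · refine integrable_bdd_mul_fourier (C := ‖(2 * Real.pi : ℂ)‖ * |B|)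
        (hFm'.const_mul _) (fun ξ => ?_) φ
      rw [norm_mul]
      gcongr
      exact hFB _

/-- Bumps bounded by `1` shrinking to `x` see the mass at `x`, whereas their integrals against a
locally integrable function vanish in the limit by dominated convergence. -/
theorem exists_schwartz_seq_tendsto_indicator (x : ℝ) : ∃ φ : ℕ → 𝓢(ℝ, ℂ),
    (∀ y, Tendsto (fun n => φ n y) atTop (𝓝 (if y = x then 1 else 0))) ∧
    ∀ u : ℝ → ℂ, LocallyIntegrable u → Tendsto (fun n => ∫ y, u y * φ n y) atTop (𝓝 0) := by
  let f : ℕ → ContDiffBump x := fun n =>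
    ⟨1 / (2 * ((n : ℝ) + 1)), 1 / ((n : ℝ) + 1), by positivity, by
      apply one_div_lt_one_div_of_lt <;> linarith [(Nat.cast_nonneg n : (0 : ℝ) ≤ n)]⟩
  have hc1 : ∀ n, HasCompactSupport (Complex.ofRealCLM ∘ f n) := fun n =>
    (f n).hasCompactSupport.comp_left rfl
  have hc2 : ∀ n, ContDiff ℝ (⊤ : ℕ∞) (Complex.ofRealCLM ∘ f n) := fun n =>
    Complex.ofRealCLM.contDiff.comp (f n).contDiff
  let φ : ℕ → 𝓢(ℝ, ℂ) := fun n => (hc1 n).toSchwartzMap (hc2 n)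
  have hφ : ∀ n y, φ n y = (f n y : ℂ) := fun n y => by simp [φ]
  have hlim : ∀ y, Tendsto (fun n => φ n y) atTop (𝓝 (if y = x then 1 else 0)) := by
    intro y
    by_cases hy : y = x
    · refine tendsto_const_nhds.congr fun n => ?_
      rw [if_pos hy, hφ, hy, (f n).one_of_mem_closedBall (Metric.mem_closedBall_self (f n).rIn_pos.le),
        Complex.ofReal_one]
    · rw [if_neg hy]
      refine tendsto_const_nhds.congr' ?_
      filter_upwards [tendsto_one_div_add_atTop_nhds_zero_nat.eventually_lt_const
        (dist_pos.2 hy)] with n hn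
      rw [hφ, (f n).zero_of_le_dist hn.le, Complex.ofReal_zero]
  refine ⟨φ, hlim, fun u hu => ?_⟩
  have hball : IntegrableOn u (Metric.closedBall x 1) :=
    hu.integrableOn_isCompact (isCompact_closedBall x 1)
  have h := tendsto_integral_of_dominated_convergence (μ := volume)
    (F := fun n y => u y * φ n y) (f := fun _ => 0)
    ((Metric.closedBall x 1).indicator fun y => ‖u y‖)
    (fun n => hu.aestronglyMeasurable.mul (φ n).continuous.aestronglyMeasurable)
    ((integrable_indicator_iff measurableSet_closedBall).2 hball.norm)
    (fun n => .of_forall fun y => by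
      by_cases hy : y ∈ Metric.closedBall x 1
      · rw [Set.indicator_of_mem hy, norm_mul, hφ, Complex.norm_real,
          Real.norm_of_nonneg (f n).nonneg]
        exact mul_le_of_le_one_right (norm_nonneg _) (f n).le_one
      · rw [Set.indicator_of_notMem hy, hφ, (f n).zero_of_le_dist, Complex.ofReal_zero, mul_zero,
          norm_zero]
        refine le_trans ?_ (not_le.1 hy).le
        exact div_le_one_of_le₀ (by linarith [(Nat.cast_nonneg n : (0 : ℝ) ≤ n)]) (by positivity))
    (by
      have hx : ∀ᵐ y : ℝ, y ≠ x := by simp [ae_iff]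
      filter_upwards [hx] with y hy
      simpa [hy] using (hlim y).const_mul (u y))
  simpa using h

/-- The terms with `g` cancel, so the difference of the two measures is a locally integrable
function. Tested on shrinking bumps it has no atoms, and the weights `-1/α` agree at every point. -/
theorem MultipointPotential.same_of_differenceMemLs {v w : MultipointPotential ℝ}
    (hv : ∀ j, v.α j ≠ 0) (hw : ∀ j, w.α j ≠ 0) {g : ℝ → ℂ} {E₀ : ℝ} {s : ℝ≥0∞} (hs : 1 ≤ s)
    (h1 : DifferenceMemLs v.v11 g E₀ s) (h2 : DifferenceMemLs w.v11 g E₀ s) : v.Same w := by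
  obtain ⟨u₁, hu₁, h1⟩ := h1
  obtain ⟨u₂, hu₂, h2⟩ := h2
  refine same_of_pointMass_eq (g := fun a => -1 / a)
    (fun a b hab => by simpa [neg_div] using hab)
    (fun j => by simp [hv j]) (fun j => by simp [hw j]) ?_
  ext x
  obtain ⟨φ, hφ, hφu⟩ := exists_schwartz_seq_tendsto_indicator x
  have hlim : ∀ v : MultipointPotential ℝ, Tendsto
      (fun n => ∫ᵛ y, φ n y ∂[ContinuousLinearMap.mul ℝ ℂ; v.v11]) atTop
      (𝓝 (pointMass (fun j => -1 / v.α j) v.y x)) := by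
    intro v
    simp_rw [v11, integral_discreteMeasure]
    have : pointMass (fun j => -1 / v.α j) v.y x
        = ∑ j, (if v.y j = x then (1 : ℂ) else 0) * (-1 / v.α j) := by
      classical
      simp [pointMass, Finsupp.finsetSum_apply, Finsupp.single_apply]
    rw [this]
    exact tendsto_finsetSum _ fun j _ => (hφ _).mul_const _
  have hd := (hφu u₁ (hu₁.locallyIntegrable hs)).sub (hφu u₂ (hu₂.locallyIntegrable hs))
  rw [sub_zero] at hd
  have hd' := (hlim v).sub (hlim w)
  refine sub_eq_zero.1 (tendsto_nhds_unique hd' (hd.congr fun n => ?_))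
  rw [← (h1 (φ n)).2, ← (h2 (φ n)).2, sub_sub_sub_cancel_right]

theorem DifferenceMemLs.congr {μ : ComplexMeasure ℝ} {g g' : ℝ → ℂ} {E₀ : ℝ} {s : ℝ≥0∞}
    (h : DifferenceMemLs μ g E₀ s) (hg : ∀ p, 2 * √E₀ < |p| → g p = g' p) :
    DifferenceMemLs μ g' E₀ s := by
  obtain ⟨u, hu, h⟩ := h
  have hSm := MultipointPotential.measurableSet_lt_abs (2 * √E₀)
  refine ⟨u, hu, fun φ => ?_⟩
  have hcong : Set.EqOn (fun p : ℝ => g p * ∫ x : ℝ, Complex.exp (-(Complex.I * p * x)) * φ x)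
      (fun p : ℝ => g' p * ∫ x : ℝ, Complex.exp (-(Complex.I * p * x)) * φ x)
      {p : ℝ | 2 * √E₀ < |p|} := fun p hp => by simp only [hg p hp]
  refine ⟨(h φ).1.congr_fun hcong hSm, ?_⟩
  rw [← setIntegral_congr_fun hSm hcong]
  exact (h φ).2

end Distribution

/-! ### Uniqueness from equal amplitudes -/

section EqualAmplitudes

variable {V : Type*} [NormedAddCommGroup V] [InnerProductSpace ℝ V] {γ : V → V}

theorem SameAmplitudeAbove.eventually_eq {v w : MultipointPotential V} {E₀ : ℝ} {p : V}
    (h : SameAmplitudeAbove γ v w E₀ p) (hv : ∀ᶠ κ in atTop, v.SolvableAt κ)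
    (hw : ∀ᶠ κ in atTop, w.SolvableAt κ) :
    ∀ᶠ E in atTop, v.amplitude (kE γ E p) (lE γ E p) = w.amplitude (kE γ E p) (lE γ E p) := by
  filter_upwards [Real.tendsto_sqrt_atTop.eventually hv, Real.tendsto_sqrt_atTop.eventually hw,
    Real.tendsto_sqrt_atTop.eventually_gt_atTop (‖p‖ / 2), eventually_gt_atTop E₀]
    with E h1 h2 h3 h4
  exact h E h4 (by linarith) h1 h2

end EqualAmplitudes

namespace MultipointPotential

section Two

variable {γ : EuclideanSpace ℝ (Fin 2) → EuclideanSpace ℝ (Fin 2)}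

theorem tendsto_log_sqrt : Tendsto (fun E : ℝ => Real.log √E) atTop atTop :=
  Real.tendsto_log_atTop.comp Real.tendsto_sqrt_atTop

theorem amplitude_two_kE_expansion (hγ : IsUnitTransverse γ)
    (v : MultipointPotential (EuclideanSpace ℝ (Fin 2))) (p : EuclideanSpace ℝ (Fin 2)) :
    (fun E : ℝ => v.amplitude (kE γ E p) (lE γ E p)
        - (fourierOfMeasure v.v21 p / (Real.log √E : ℂ)
          + fourierOfMeasure v.v22 p / (Real.log √E : ℂ) ^ 2))
      =O[atTop] fun E : ℝ => (Real.log √E ^ 3)⁻¹ :=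
  v.amplitude_two_expansion (eventually_norm_kE hγ p) fun E => kE_sub_lE γ E p

theorem tendsto_v21 (hγ : IsUnitTransverse γ)
    (v : MultipointPotential (EuclideanSpace ℝ (Fin 2))) (p : EuclideanSpace ℝ (Fin 2)) :
    Tendsto (fun E : ℝ => (Real.log √E : ℂ) * v.amplitude (kE γ E p) (lE γ E p))
      atTop (𝓝 (fourierOfMeasure v.v21 p)) :=
  tendsto_first_coefficient tendsto_log_sqrt (isBigO_const_const _ one_ne_zero _)
    (v.amplitude_two_kE_expansion hγ p)

theorem tendsto_v22 (hγ : IsUnitTransverse γ)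
    (v : MultipointPotential (EuclideanSpace ℝ (Fin 2))) (p : EuclideanSpace ℝ (Fin 2)) :
    Tendsto (fun E : ℝ => (Real.log √E : ℂ) ^ 2 * (v.amplitude (kE γ E p) (lE γ E p)
        - fourierOfMeasure v.v21 p / (Real.log √E : ℂ)))
      atTop (𝓝 (fourierOfMeasure v.v22 p)) := by
  have h := (tendsto_second_coefficient tendsto_log_sqrt
    (v.amplitude_two_kE_expansion hγ p)).add_const (fourierOfMeasure v.v22 p)
  simpa using h

theorem fourier_two_eq_of_sameAmplitudeAbove (hγ : IsUnitTransverse γ)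
    {v w : MultipointPotential (EuclideanSpace ℝ (Fin 2))} {E₀ : ℝ}
    {p : EuclideanSpace ℝ (Fin 2)} (h : SameAmplitudeAbove γ v w E₀ p) :
    fourierOfMeasure v.v21 p = fourierOfMeasure w.v21 p ∧
      fourierOfMeasure v.v22 p = fourierOfMeasure w.v22 p := by
  have hev := h.eventually_eq v.eventually_solvableAt_two w.eventually_solvableAt_two
  have h1 : fourierOfMeasure v.v21 p = fourierOfMeasure w.v21 p :=
    tendsto_nhds_unique ((v.tendsto_v21 hγ p).congr' (hev.mono fun E hE => by rw [hE]))
      (w.tendsto_v21 hγ p)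
  exact ⟨h1, tendsto_nhds_unique ((v.tendsto_v22 hγ p).congr' (hev.mono fun E hE => by
    rw [hE, h1])) (w.tendsto_v22 hγ p)⟩

/-- The coefficient of `v₂,₂` at a point of strength `a`. -/
def coefficient22 (a : ℂ) : ℂ := 4 * (Real.pi : ℂ) ^ 2 * (a - Complex.I / 4)

theorem coefficient22_injective : Function.Injective coefficient22 := by
  intro a b h
  simpa [coefficient22, Real.pi_ne_zero] using h

theorem coefficient22_ne_zero {a : ℂ} (ha : a ≠ Complex.I / 4) : coefficient22 a ≠ 0 := by
  simp [coefficient22, Real.pi_ne_zero, sub_eq_zero, ha]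

variable {v w : MultipointPotential (EuclideanSpace ℝ (Fin 2))}

theorem v21_eq_and_samePoints (h : fourierOfMeasure v.v21 = fourierOfMeasure w.v21) :
    v.v21 = w.v21 ∧ v.SamePoints w := by
  have hm := pointMass_eq_of_fourierOfMeasure_eq h
  exact ⟨(discreteMeasure_eq_iff _ _ _ _).2 hm, samePoints_of_pointMass_eq
    (fun _ => by simp [Real.pi_ne_zero]) (fun _ => by simp [Real.pi_ne_zero]) hm⟩

theorem pointMass_eq_of_fourier_v22_eq (h : fourierOfMeasure v.v22 = fourierOfMeasure w.v22) :
    pointMass (fun j => coefficient22 (v.α j)) v.y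
      = pointMass (fun j => coefficient22 (w.α j)) w.y :=
  pointMass_eq_of_fourierOfMeasure_eq h

theorem same_of_fourier_two_eq (h1 : fourierOfMeasure v.v21 = fourierOfMeasure w.v21)
    (h2 : fourierOfMeasure v.v22 = fourierOfMeasure w.v22) : v.Same w :=
  (v21_eq_and_samePoints h1).2.same_of_pointMass_eq coefficient22_injective
    (pointMass_eq_of_fourier_v22_eq h2)

end Two

section Three

variable {γ : EuclideanSpace ℝ (Fin 3) → EuclideanSpace ℝ (Fin 3)}

theorem amplitude_three_kE_expansion (hγ : IsUnitTransverse γ)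
    (v : MultipointPotential (EuclideanSpace ℝ (Fin 3))) (p : EuclideanSpace ℝ (Fin 3)) :
    (fun E : ℝ => v.amplitude (kE γ E p) (lE γ E p)
        - (fourierOfMeasure v.v31 p / (√E : ℂ)
          + (fourierOfMeasure v.v321 p + v.f322 (kE γ E p) (lE γ E p)) / (√E : ℂ) ^ 2))
      =O[atTop] fun E : ℝ => (√E ^ 3)⁻¹ :=
  v.amplitude_three_expansion (eventually_norm_kE hγ p) fun E => kE_sub_lE γ E p

theorem tendsto_v31 (hγ : IsUnitTransverse γ)
    (v : MultipointPotential (EuclideanSpace ℝ (Fin 3))) (p : EuclideanSpace ℝ (Fin 3)) :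
    Tendsto (fun E : ℝ => (√E : ℂ) * v.amplitude (kE γ E p) (lE γ E p))
      atTop (𝓝 (fourierOfMeasure v.v31 p)) :=
  tendsto_first_coefficient Real.tendsto_sqrt_atTop
    ((isBigO_const_const _ one_ne_zero _).add (v.f322_isBigO _ _ _))
    (v.amplitude_three_kE_expansion hγ p)

theorem tendsto_v321 (hγ : IsUnitTransverse γ)
    (v : MultipointPotential (EuclideanSpace ℝ (Fin 3))) (p : EuclideanSpace ℝ (Fin 3)) :
    Tendsto (fun E : ℝ => (√E : ℂ) ^ 2 *
        (v.amplitude (kE γ E p) (lE γ E p) - fourierOfMeasure v.v31 p / (√E : ℂ))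
          - v.f322 (kE γ E p) (lE γ E p))
      atTop (𝓝 (fourierOfMeasure v.v321 p)) := by
  have h := (tendsto_second_coefficient Real.tendsto_sqrt_atTop
    (v.amplitude_three_kE_expansion hγ p)).add_const (fourierOfMeasure v.v321 p)
  rw [zero_add] at h
  refine h.congr fun E => ?_
  ring

theorem fourier_v31_eq_of_sameAmplitudeAbove (hγ : IsUnitTransverse γ)
    {v w : MultipointPotential (EuclideanSpace ℝ (Fin 3))} {E₀ : ℝ}
    {p : EuclideanSpace ℝ (Fin 3)} (h : SameAmplitudeAbove γ v w E₀ p) :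
    fourierOfMeasure v.v31 p = fourierOfMeasure w.v31 p :=
  tendsto_nhds_unique ((v.tendsto_v31 hγ p).congr' ((h.eventually_eq
    v.eventually_solvableAt_three w.eventually_solvableAt_three).mono fun E hE => by rw [hE]))
    (w.tendsto_v31 hγ p)

/-- Equality of the point sets is needed so that the same `f₃,₂²` is subtracted on both sides. -/
theorem fourier_v321_eq_of_sameAmplitudeAbove (hγ : IsUnitTransverse γ)
    {v w : MultipointPotential (EuclideanSpace ℝ (Fin 3))} {E₀ : ℝ}
    {p : EuclideanSpace ℝ (Fin 3)} (h : SameAmplitudeAbove γ v w E₀ p) (hp : v.SamePoints w) :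
    fourierOfMeasure v.v321 p = fourierOfMeasure w.v321 p :=
  tendsto_nhds_unique ((v.tendsto_v321 hγ p).congr' ((h.eventually_eq
    v.eventually_solvableAt_three w.eventually_solvableAt_three).mono fun E hE => by
      rw [hE, fourier_v31_eq_of_sameAmplitudeAbove hγ h, hp.f322_eq]))
    (w.tendsto_v321 hγ p)

/-- The coefficient of `v₃,₂¹` at a point of strength `a`. -/
def coefficient321 (a : ℂ) : ℂ := -16 * (Real.pi : ℂ) ^ 2 * a

theorem coefficient321_injective : Function.Injective coefficient321 := by
  intro a b h
  simpa [coefficient321, Real.pi_ne_zero] using h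

theorem coefficient321_ne_zero {a : ℂ} (ha : a ≠ 0) : coefficient321 a ≠ 0 := by
  simp [coefficient321, Real.pi_ne_zero, ha]

variable {v w : MultipointPotential (EuclideanSpace ℝ (Fin 3))}

theorem v31_eq_of_fourier_eq (h : fourierOfMeasure v.v31 = fourierOfMeasure w.v31) :
    v.v31 = w.v31 :=
  (discreteMeasure_eq_iff _ _ _ _).2 (pointMass_eq_of_fourierOfMeasure_eq h)

theorem v31_eq_iff_samePoints : v.v31 = w.v31 ↔ v.SamePoints w := by
  refine ⟨fun h => samePoints_of_pointMass_eq (fun _ => ?_) (fun _ => ?_)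
    ((discreteMeasure_eq_iff _ _ _ _).1 h),
    fun h => (discreteMeasure_eq_iff _ _ _ _).2 (h.pointMass_const_eq _)⟩ <;>
  simp [Real.pi_ne_zero]

theorem pointMass_eq_of_fourier_v321_eq
    (h : fourierOfMeasure v.v321 = fourierOfMeasure w.v321) :
    pointMass (fun j => coefficient321 (v.α j)) v.y
      = pointMass (fun j => coefficient321 (w.α j)) w.y :=
  pointMass_eq_of_fourierOfMeasure_eq h

theorem SamePoints.same_of_fourier_v321_eq (hp : v.SamePoints w)
    (h : fourierOfMeasure v.v321 = fourierOfMeasure w.v321) : v.Same w :=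
  hp.same_of_pointMass_eq coefficient321_injective (pointMass_eq_of_fourier_v321_eq h)

end Three

section One

theorem eventually_solvableAt_one (v : MultipointPotential ℝ) (hα : ∀ j, v.α j ≠ 0) :
    ∀ᶠ κ in atTop, v.SolvableAt κ := by
  filter_upwards [eventually_gt_atTop 0,
    eventually_ge_atTop (2 * (v.n * v.inverseStrength))] with κ h1 h2
  exact v.solvableAt_one hα h1 h2

/-- The cut-off may be raised freely: above a common threshold the two amplitudes agree, so both
potentials differ from the same truncated integral by an `L²` function. -/
theorem same_of_backscattering_eq {v w : MultipointPotential ℝ} (hv : ∀ j, v.α j ≠ 0)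
    (hw : ∀ j, w.α j ≠ 0) {E₀ : ℝ}
    (h : ∀ k : ℝ, √E₀ < |k| → v.SolvableAt |k| → w.SolvableAt |k| →
      v.amplitude k (-k) = w.amplitude k (-k)) : v.Same w := by
  -- Beyond `a` both systems are solvable and `a` exceeds both `0` and, weakly, `√E₀`; the new
  -- cut-off energy is `a²`.
  obtain ⟨a, ha⟩ := eventually_atTop.1 ((v.eventually_solvableAt_one hv).and
    ((w.eventually_solvableAt_one hw).and ((eventually_gt_atTop 0).and
      (eventually_ge_atTop √E₀))))
  have ha0 : 0 < a := (ha a le_rfl).2.2.1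
  have hsqrt : √(a ^ 2) = a := Real.sqrt_sq ha0.le
  have h2 : (2 : ℝ≥0∞) < ∞ := ENNReal.ofNat_lt_top
  refine same_of_differenceMemLs hv hw (g := v.backscattering) (E₀ := a ^ 2) (s := 2)
    (by norm_num) (differenceMemLs_backscattering v hv (by positivity)
      (fun κ hκ => (ha κ (hsqrt ▸ hκ)).1) le_rfl h2)
    ((differenceMemLs_backscattering w hw (by positivity)
      (fun κ hκ => (ha κ (hsqrt ▸ hκ)).2.1) le_rfl h2).congr fun p hp => ?_)
  rw [hsqrt] at hp
  have hp2 : a < |p / 2| := by rw [abs_div, abs_two]; linarith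
  obtain ⟨h3, h4, -, h5⟩ := ha _ hp2.le
  rw [backscattering, backscattering, neg_div]
  exact (h _ ((ha a le_rfl).2.2.2.trans_lt hp2) h3 h4).symm

end One

end MultipointPotential

end

/-! ### The theorem in all three dimensions -/

theorem theorem3p2 :
    -- dimension two
    (∀ γ : EuclideanSpace ℝ (Fin 2) → EuclideanSpace ℝ (Fin 2), IsUnitTransverse γ →
      (∀ v : MultipointPotential (EuclideanSpace ℝ (Fin 2)),
        (∃ κ₀ : ℝ, ∀ κ : ℝ, κ₀ ≤ κ → v.SolvableAt κ) ∧
        ∀ p : EuclideanSpace ℝ (Fin 2),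
          ((fun E : ℝ => v.amplitude (kE γ E p) (lE γ E p)
              - (fourierOfMeasure v.v21 p / (Real.log √E : ℂ)
                + fourierOfMeasure v.v22 p / (Real.log √E : ℂ) ^ 2))
            =O[atTop] fun E : ℝ => (Real.log √E ^ 3)⁻¹) ∧
          Tendsto (fun E : ℝ => (Real.log √E : ℂ) * v.amplitude (kE γ E p) (lE γ E p))
            atTop (𝓝 (fourierOfMeasure v.v21 p)) ∧
          Tendsto (fun E : ℝ => (Real.log √E : ℂ) ^ 2 *
              (v.amplitude (kE γ E p) (lE γ E p)
                - fourierOfMeasure v.v21 p / (Real.log √E : ℂ)))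
            atTop (𝓝 (fourierOfMeasure v.v22 p))) ∧
      (∀ v w : MultipointPotential (EuclideanSpace ℝ (Fin 2)),
        (∀ E₀ : ℝ, 0 < E₀ → ∀ p : EuclideanSpace ℝ (Fin 2), SameAmplitudeAbove γ v w E₀ p →
          fourierOfMeasure v.v21 p = fourierOfMeasure w.v21 p ∧
          fourierOfMeasure v.v22 p = fourierOfMeasure w.v22 p) ∧
        (fourierOfMeasure v.v21 = fourierOfMeasure w.v21 → v.v21 = w.v21 ∧ v.SamePoints w) ∧
        (fourierOfMeasure v.v22 = fourierOfMeasure w.v22 →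
          v.v22 = w.v22 ∧
          (∀ x a, a ≠ Complex.I / 4 → (v.HasPoint x a ↔ w.HasPoint x a)) ∧
          ((∀ j, v.α j ≠ Complex.I / 4) → (∀ j, w.α j ≠ Complex.I / 4) → v.Same w)) ∧
        (fourierOfMeasure v.v21 = fourierOfMeasure w.v21 →
          fourierOfMeasure v.v22 = fourierOfMeasure w.v22 → v.Same w) ∧
        (∀ E₀ : ℝ, 0 < E₀ → (∀ p, SameAmplitudeAbove γ v w E₀ p) → v.Same w))) ∧
    -- dimension three
    (∀ γ : EuclideanSpace ℝ (Fin 3) → EuclideanSpace ℝ (Fin 3), IsUnitTransverse γ →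
      (∀ v : MultipointPotential (EuclideanSpace ℝ (Fin 3)),
        (∃ κ₀ : ℝ, ∀ κ : ℝ, κ₀ ≤ κ → v.SolvableAt κ) ∧
        ∀ p : EuclideanSpace ℝ (Fin 3),
          ((fun E : ℝ => v.amplitude (kE γ E p) (lE γ E p)
              - (fourierOfMeasure v.v31 p / (√E : ℂ)
                + (fourierOfMeasure v.v321 p + v.f322 (kE γ E p) (lE γ E p)) / (√E : ℂ) ^ 2))
            =O[atTop] fun E : ℝ => (√E ^ 3)⁻¹) ∧
          Tendsto (fun E : ℝ => (√E : ℂ) * v.amplitude (kE γ E p) (lE γ E p))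
            atTop (𝓝 (fourierOfMeasure v.v31 p)) ∧
          Tendsto (fun E : ℝ => (√E : ℂ) ^ 2 *
              (v.amplitude (kE γ E p) (lE γ E p) - fourierOfMeasure v.v31 p / (√E : ℂ))
                - v.f322 (kE γ E p) (lE γ E p))
            atTop (𝓝 (fourierOfMeasure v.v321 p))) ∧
      (∀ v w : MultipointPotential (EuclideanSpace ℝ (Fin 3)),
        (∀ E₀ : ℝ, 0 < E₀ → ∀ p : EuclideanSpace ℝ (Fin 3), SameAmplitudeAbove γ v w E₀ p →
          fourierOfMeasure v.v31 p = fourierOfMeasure w.v31 p ∧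
          (v.SamePoints w → fourierOfMeasure v.v321 p = fourierOfMeasure w.v321 p)) ∧
        (fourierOfMeasure v.v31 = fourierOfMeasure w.v31 → v.v31 = w.v31) ∧
        (v.v31 = w.v31 ↔ v.SamePoints w) ∧
        (v.SamePoints w → v.f322 = w.f322) ∧
        (fourierOfMeasure v.v321 = fourierOfMeasure w.v321 →
          v.v321 = w.v321 ∧
          (∀ x a, a ≠ 0 → (v.HasPoint x a ↔ w.HasPoint x a)) ∧
          ((∀ j, v.α j ≠ 0) → (∀ j, w.α j ≠ 0) → v.Same w)) ∧
        (v.SamePoints w → fourierOfMeasure v.v321 = fourierOfMeasure w.v321 → v.Same w) ∧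
        (∀ E₀ : ℝ, 0 < E₀ → (∀ p, SameAmplitudeAbove γ v w E₀ p) → v.Same w))) ∧
    -- dimension one
    ((∀ v : MultipointPotential ℝ, (∀ j, v.α j ≠ 0) →
        (∃ κ₀ : ℝ, ∀ κ : ℝ, κ₀ ≤ κ → v.SolvableAt κ) ∧
        ∀ E₀ : ℝ, 0 < E₀ → (∀ κ : ℝ, √E₀ ≤ κ → v.SolvableAt κ) →
          ∀ s : ℝ≥0∞, 2 ≤ s → s < ∞ →
            DifferenceMemLs v.v11 (fun p => v.amplitude (p / 2) (-p / 2)) E₀ s ∧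
            ∀ w : MultipointPotential ℝ, (∀ j, w.α j ≠ 0) →
              DifferenceMemLs w.v11 (fun p => v.amplitude (p / 2) (-p / 2)) E₀ s → v.Same w) ∧
      (∀ v w : MultipointPotential ℝ, (∀ j, v.α j ≠ 0) → (∀ j, w.α j ≠ 0) →
        ∀ E₀ : ℝ, 0 < E₀ →
          (∀ k : ℝ, √E₀ < |k| → v.SolvableAt |k| → w.SolvableAt |k| →
            v.amplitude k (-k) = w.amplitude k (-k)) → v.Same w)) := by
  refine ⟨fun γ hγ => ⟨fun v => ⟨eventually_atTop.1 v.eventually_solvableAt_two, fun p =>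
      ⟨v.amplitude_two_kE_expansion hγ p, v.tendsto_v21 hγ p, v.tendsto_v22 hγ p⟩⟩,
    fun v w => ⟨fun _ _ p h => MultipointPotential.fourier_two_eq_of_sameAmplitudeAbove hγ h,
      MultipointPotential.v21_eq_and_samePoints, fun h => ?_,
      MultipointPotential.same_of_fourier_two_eq, fun E₀ _ h => ?_⟩⟩,
    fun γ hγ => ⟨fun v => ⟨eventually_atTop.1 v.eventually_solvableAt_three, fun p =>
      ⟨v.amplitude_three_kE_expansion hγ p, v.tendsto_v31 hγ p, v.tendsto_v321 hγ p⟩⟩,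
    fun v w => ⟨fun _ _ p h =>
        ⟨MultipointPotential.fourier_v31_eq_of_sameAmplitudeAbove hγ h,
          MultipointPotential.fourier_v321_eq_of_sameAmplitudeAbove hγ h⟩,
      MultipointPotential.v31_eq_of_fourier_eq, MultipointPotential.v31_eq_iff_samePoints,
      MultipointPotential.SamePoints.f322_eq, fun h => ?_,
      MultipointPotential.SamePoints.same_of_fourier_v321_eq, fun E₀ _ h => ?_⟩⟩,
    fun v hv => ⟨eventually_atTop.1 (v.eventually_solvableAt_one hv), fun E₀ hE hs s h2 hs' => ?_⟩,
    fun v w hv hw E₀ _ h => MultipointPotential.same_of_backscattering_eq hv hw h⟩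
  · have hm := MultipointPotential.pointMass_eq_of_fourier_v22_eq h
    exact ⟨(discreteMeasure_eq_iff _ _ _ _).2 hm, fun x a ha =>
        MultipointPotential.hasPoint_iff_of_pointMass_eq
          MultipointPotential.coefficient22_injective hm x
          (MultipointPotential.coefficient22_ne_zero ha),
      fun hv hw => MultipointPotential.same_of_pointMass_eq
        MultipointPotential.coefficient22_injective
        (fun j => MultipointPotential.coefficient22_ne_zero (hv j))
        (fun j => MultipointPotential.coefficient22_ne_zero (hw j)) hm⟩
  · exact MultipointPotential.same_of_fourier_two_eq
      (funext fun p => (MultipointPotential.fourier_two_eq_of_sameAmplitudeAbove hγ (h p)).1)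
      (funext fun p => (MultipointPotential.fourier_two_eq_of_sameAmplitudeAbove hγ (h p)).2)
  · have hm := MultipointPotential.pointMass_eq_of_fourier_v321_eq h
    exact ⟨(discreteMeasure_eq_iff _ _ _ _).2 hm, fun x a ha =>
        MultipointPotential.hasPoint_iff_of_pointMass_eq
          MultipointPotential.coefficient321_injective hm x
          (MultipointPotential.coefficient321_ne_zero ha),
      fun hv hw => MultipointPotential.same_of_pointMass_eq
        MultipointPotential.coefficient321_injective
        (fun j => MultipointPotential.coefficient321_ne_zero (hv j))
        (fun j => MultipointPotential.coefficient321_ne_zero (hw j)) hm⟩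
  · have hp := MultipointPotential.v31_eq_iff_samePoints.1
      (MultipointPotential.v31_eq_of_fourier_eq (funext fun p =>
        MultipointPotential.fourier_v31_eq_of_sameAmplitudeAbove hγ (h p)))
    exact hp.same_of_fourier_v321_eq (funext fun p =>
      MultipointPotential.fourier_v321_eq_of_sameAmplitudeAbove hγ (h p) hp)
  · have hd := differenceMemLs_backscattering v hv hE hs h2 hs'
    exact ⟨hd, fun w hw h => MultipointPotential.same_of_differenceMemLs hv hw
      (le_trans (by norm_num) h2) hd h⟩
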